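/- **Definitions.** Let $U$ (users) and $R$ (resources) be finite sets, $k=|R|$, and let an authorization relation be a set $A\subseteq U\times R$. $A$ is *complete* if for every $r\in R$ there is $u\in U$ with $(u,r)\in A$; $A-u$ denotes $A\setminus(\{u\}\times R)$, and $A(u)=\{r\in R:(u,r)\in A\}$. An instance of **APEP** consists of $U$, $R$, a base relation $\hat A\subseteq U\times R$ and a finite collection $C$ of constraints. A constraint is an arbitrary condition on $A\subseteq U\times R$, presented in the input by a Boolean circuit with one variable per pair $(u,r)$. The question is whether there is a complete $A\subseteq\hat A$ that satisfies all constraints in $C$. An instance of **Valued APEP** (decision version) consists of $U$, $R$, a finite collection $C$ of weighted constraints $w_c:2^{U\times R}\to\mathbb N$, a function $\omega:U\times 2^R\to\mathbb N$ such that $\omega(u,\cdot)$ is monotone under inclusion and $\omega(u,T)=0$ whenever $\omega(u,\{r\})=0$ for all $r\in T$, and a budget $b\in\mathbb N$ in binary; each $w_c$ and each $\omega(u,\cdot)$ is presented by a Boolean circuit that outputs the binary digits of its value. The question is whether there is a complete $A$ with $\sum_{u\in U}\omega(u,A(u))+\sum_{c\in C}w_c(A)\le b$. A collection $C$ of weighted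 constraints is *$t$-wbounded* if for each complete $A$ with $|A|>t$ there is a complete $A'\subseteq A$ with $|A'|<|A|$ and $\sum_{c\in C}w_c(A')\le\sum_{c\in C}w_c(A)$; an unweighted constraint has weight $0$ on the relations that satisfy it and $1$ on the others. An unweighted constraint $c$ is *$t$-bounded* if for each complete $A$ satisfying $c$ there is $U'\subseteq U$ with $|U'|\le t$ such that for each $u\in U\setminus U'$ the relation $A-u$ is complete and satisfies $c$. A weighted constraint $w_c$ is *$t$-bounded* if for each complete $A$ there is $U'\subseteq U$ with $|U'|\le t$ such that for each $u\in U\setminus U'$ the relation $A-u$ is complete and $w_c(A-u)\le w_c(A)$. A *parameterized reduction* from $\Pi$ to $\Pi'$ maps each instance $(I,\kappa)$ of $\Pi$ to an instance $(I',\kappa')$ of $\Pi'$ with the same answer and with $\kappa'\le g(\kappa)$, and is computed by a Turing machine in at most $h(\kappa)\,(|I|+\kappa+1)^{c}$ steps, for computable $g,h:\mathbb N\to\mathbb N$ and a constant $c$. W[1] is the class of problems that, for some constant $d$, have a parameterized reduction to the following problem: given a Boolean circuit of depth at most $d$ in which every path to the output contains at most one gate of fan-in greater than $2$, and a parameter $\kappa$,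 is there a satisfying assignment that sets exactly $\kappa$ variables to true? A problem is W[1]-hard if every problem in W[1] has a parameterized reduction to it. **Theorem.** APEP and Valued APEP, parameterized by the number of resources $k$, are W[1]-hard. Each of them remains W[1]-hard when restricted to the instances in which $C$ is $k$-wbounded and every constraint in $C$ is $k$-bounded. -/

import Mathlib

namespace ParamAPEP

/-! ### Words over the binary alphabet -/

/-- A natural number in unary, self-delimiting. -/
def natWord (m : ℕ) : List Bool := List.replicate m true ++ [false]

/-- A list: each entry is announced by the bit `true`, the end of the list by `false`.
The words of the entries have to be self-delimiting. -/
def listWord {α : Type} (e : α → List Bool) (l : List α) : List Bool :=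
  l.flatMap (fun x => true :: e x) ++ [false]

/-- A natural number in binary (least significant bit first), self-delimiting. -/
def binaryWord (m : ℕ) : List Bool := listWord (fun b => [b]) m.bits

/-! ### Parameterized problems and parameterized reductions -/

/-- A parameterized decision problem: instances, each presented by a binary word `encode I` (its
main part) and a parameter `param I`, together with the set of yes-instances. Only instances count
as inputs, so the restriction of a problem to some of its instances is again a problem. -/
structure ParamProblem where
  Inst : Type
  encode : Inst → List Bool
  param : Inst → ℕ
  Yes : Inst → Prop

namespace ParamProblem

/-- What a machine reads or writes for an instance: the parameter in unary, followed by the main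
part. Its length is `|I| + κ + 1`. -/
def word (P : ParamProblem) (I : P.Inst) : List Bool :=
  natWord (P.param I) ++ P.encode I

/-- The restriction of a problem to the instances with a property `p`. -/
def restrict (P : ParamProblem) (p : P.Inst → Prop) : ParamProblem where
  Inst := {I : P.Inst // p I}
  encode I := P.encode I.1
  param I := P.param I.1
  Yes I := P.Yes I.1

/-- `P` has a parameterized reduction to `Q`: a map from instances to instances that preserves the
answer, such that the new parameter is at most `g κ`, and that is computed by a (multi-stack)
Turing machine in at most `h κ * (|I| + κ + 1) ^ c` steps, for computable `g`, `h` and a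
constant `c`. -/
def Reduces (P Q : ParamProblem) : Prop :=
  ∃ (f : P.Inst → Q.Inst) (g h : ℕ → ℕ) (c : ℕ) (M : Turing.TM2ComputableAux Bool Bool),
    Computable g ∧ Computable h ∧
    (∀ I, P.Yes I ↔ Q.Yes (f I)) ∧
    (∀ I, Q.param (f I) ≤ g (P.param I)) ∧
    (∀ I, Nonempty (Turing.TM2OutputsInTime M.tm
      ((P.word I).map M.inputAlphabet.symm)
      (some ((Q.word (f I)).map M.outputAlphabet.symm))
      (h (P.param I) * (P.word I).length ^ c)))

end ParamProblem

/-! ### Boolean circuits -/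

/-- A gate of a circuit with input variables in `ι`. Gates of a circuit are numbered; the arguments
of a gate are given by their numbers. Conjunctions and disjunctions have unbounded fan-in. -/
inductive Gate (ι : Type) : Type
  | input (i : ι)
  | neg (j : ℕ)
  | conj (js : List ℕ)
  | disj (js : List ℕ)

namespace Gate

variable {ι : Type}

/-- The numbers of the gates that feed a gate. -/
def args : Gate ι → List ℕ
  | input _ => []
  | neg j => [j]
  | conj js => js
  | disj js => js

/-- The value of a gate under the assignment `a`, when gate `j` has the value `v j`. -/
def eval (a : ι → Bool) (v : ℕ → Bool) : Gate ι → Bool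
  | input i => a i
  | neg j => !(v j)
  | conj js => js.all v
  | disj js => js.any v

/-- A gate is large if it is a conjunction or a disjunction with more than two arguments. -/
def isLarge : Gate ι → Bool
  | input _ => false
  | neg _ => false
  | conj js => decide (2 < js.length)
  | disj js => decide (2 < js.length)

/-- The length of a longest path that ends in a gate, from the lengths `v j` for gates `j`. -/
def depthFrom (v : ℕ → ℕ) : Gate ι → ℕ
  | input _ => 0
  | neg j => v j + 1
  | conj js => (js.map v).foldr max 0 + 1
  | disj js => (js.map v).foldr max 0 + 1

/-- The largest number of large gates on a path that ends in the gate `g`, from these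
numbers `v j` for gates `j`. -/
def weftFrom (v : ℕ → ℕ) (g : Gate ι) : ℕ :=
  (g.args.map v).foldr max 0 + (if g.isLarge then 1 else 0)

/-- A binary word for a gate, from words for the variables. -/
def word (e : ι → List Bool) : Gate ι → List Bool
  | input i => [false, false] ++ e i
  | neg j => [false, true] ++ natWord j
  | conj js => [true, false] ++ listWord natWord js
  | disj js => [true, true] ++ listWord natWord js

end Gate

/-- Goes through a list of gates in order and computes a value for each gate from the values of
the earlier gates; `d` stands for values that are not available. -/
def gateFold {ι α : Type} (step : (ℕ → α) → Gate ι → α) (d : α) (gates : List (Gate ι)) : List α :=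
  gates.foldl (fun vs g => vs ++ [step (fun j => vs.getD j d) g]) []

/-- A Boolean circuit (an acyclic network of gates, listed in a topological order) with a list of
output gates. -/
structure Circuit (ι : Type) where
  gates : List (Gate ι)
  acyclic : ∀ (i : ℕ) (hi : i < gates.length), ∀ j ∈ (gates[i]).args, j < i
  outs : List ℕ
  outs_lt : ∀ j ∈ outs, j < gates.length

namespace Circuit

variable {ι : Type}

/-- The value of gate number `j` under the assignment `a`. -/
def gateValue (C : Circuit ι) (a : ι → Bool) (j : ℕ) : Bool :=
  (gateFold (fun v g => g.eval a v) false C.gates).getD j false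

/-- The number whose binary digits, least significant first, are the values of the output gates. -/
def number (C : Circuit ι) (a : ι → Bool) : ℕ :=
  Nat.ofDigits 2 (C.outs.map fun j => (C.gateValue a j).toNat)

/-- The length of a longest path that ends in gate number `j`. -/
def depth (C : Circuit ι) (j : ℕ) : ℕ :=
  (gateFold (fun v g => g.depthFrom v) 0 C.gates).getD j 0

/-- The largest number of large gates on a path that ends in gate number `j`. -/
def weft (C : Circuit ι) (j : ℕ) : ℕ :=
  (gateFold (fun v g => g.weftFrom v) 0 C.gates).getD j 0

/-- A binary word for a circuit, from words for the variables. -/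
def word (e : ι → List Bool) (C : Circuit ι) : List Bool :=
  listWord (Gate.word e) C.gates ++ listWord natWord C.outs

end Circuit

/-- A Boolean circuit with exactly one output gate. -/
structure DecisionCircuit (ι : Type) extends Circuit ι where
  out : ℕ
  outs_eq : outs = [out]

/-- The circuit accepts the assignment `a`. -/
def DecisionCircuit.Accepts {ι : Type} (C : DecisionCircuit ι) (a : ι → Bool) : Prop :=
  C.gateValue a C.out = true

/-! ### Weighted circuit satisfiability and the classes W[t] -/

/-- A circuit with input variables `0, …, numVars - 1`, and the number of variables that have to be
set to true. -/
structure WCSInstance where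
  numVars : ℕ
  circuit : DecisionCircuit (Fin numVars)
  weight : ℕ

/-- Weighted circuit satisfiability for circuits of weft at most `t` and depth at most `d`,
parameterized by the weight `κ`: is there a satisfying assignment with exactly `κ` variables set to
true? -/
def weightedCircuitSat (t d : ℕ) : ParamProblem where
  Inst := {I : WCSInstance //
    I.circuit.weft I.circuit.out ≤ t ∧ I.circuit.depth I.circuit.out ≤ d}
  encode I := natWord I.1.numVars ++ I.1.circuit.word (fun i => natWord i.val)
  param I := I.1.weight
  Yes I := ∃ a : Fin I.1.numVars → Bool,
    (Finset.univ.filter fun i => a i = true).card = I.1.weight ∧ I.1.circuit.Accepts a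

/-- The class W[t]: the problems with a parameterized reduction to weighted circuit satisfiability
for circuits of weft at most `t` and depth at most some constant. -/
def InW (t : ℕ) (P : ParamProblem) : Prop :=
  ∃ d : ℕ, P.Reduces (weightedCircuitSat t d)

/-- Every problem in W[t] has a parameterized reduction to `Q`. -/
def WHard (t : ℕ) (Q : ParamProblem) : Prop :=
  ∀ P : ParamProblem, InW t P → P.Reduces Q

/-! ### Authorization relations and constraints -/

section Relations

variable {U R : Type} [DecidableEq U] [DecidableEq R]

/-- Every resource has an authorized user. -/
def Complete (A : Finset (U × R)) : Prop := ∀ r : R, ∃ u : U, (u, r) ∈ A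

/-- The set `A(u)` of the resources for which the user `u` is authorized. -/
def resourcesOf [Fintype R] (A : Finset (U × R)) (u : U) : Finset R :=
  Finset.univ.filter fun r => (u, r) ∈ A

/-- The relation `A - u`. -/
def removeUser (A : Finset (U × R)) (u : U) : Finset (U × R) :=
  A.filter fun p => p.1 ≠ u

/-- The weight `w_C` of a finite collection of weighted constraints. -/
def totalWeight (C : List (Finset (U × R) → ℕ)) (A : Finset (U × R)) : ℕ :=
  (C.map fun w => w A).sum

/-- A collection of weighted constraints is `t`-wbounded. -/
def WBounded (t : ℕ) (C : List (Finset (U × R) → ℕ)) : Prop :=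
  ∀ A : Finset (U × R), Complete A → t < A.card →
    ∃ A' : Finset (U × R), Complete A' ∧ A' ⊆ A ∧ A'.card < A.card ∧
      totalWeight C A' ≤ totalWeight C A

/-- A constraint, given by the relations that satisfy it, is `t`-bounded. -/
def Bounded (t : ℕ) (c : Finset (U × R) → Prop) : Prop :=
  ∀ A : Finset (U × R), Complete A → c A →
    ∃ U' : Finset U, U'.card ≤ t ∧ ∀ u, u ∉ U' → Complete (removeUser A u) ∧ c (removeUser A u)

/-- A weighted constraint is `t`-bounded. -/
def BoundedWeight (t : ℕ) (w : Finset (U × R) → ℕ) : Prop :=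
  ∀ A : Finset (U × R), Complete A →
    ∃ U' : Finset U, U'.card ≤ t ∧
      ∀ u, u ∉ U' → Complete (removeUser A u) ∧ w (removeUser A u) ≤ w A

/-- A weighted user authorization function: `ω u T = 0` if `u` is authorized for each resource in
`T` (where `u` is authorized for `r` when `ω u {r} = 0`), and `ω u` is monotone. -/
def IsUserWeight (ω : U → Finset R → ℕ) : Prop :=
  (∀ u T, (∀ r ∈ T, ω u {r} = 0) → ω u T = 0) ∧
  (∀ u T' T, T' ⊆ T → ω u T' ≤ ω u T)

end Relations

/-! ### APEP -/

/-- An instance of APEP with users `0, …, n - 1` and resources `0, …, k - 1`. A constraint may be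
any condition on the authorization relation; it is presented by a Boolean circuit with one variable
for each pair `(u, r)`, which tells whether this pair belongs to the relation. -/
structure APEPInstance where
  n : ℕ
  k : ℕ
  base : Finset (Fin n × Fin k)
  constraints : List (DecisionCircuit (Fin n × Fin k))

namespace APEPInstance

/-- The relation `A` satisfies the constraint `c`. -/
def Satisfies {n k : ℕ} (A : Finset (Fin n × Fin k)) (c : DecisionCircuit (Fin n × Fin k)) : Prop :=
  c.Accepts fun p => decide (p ∈ A)

/-- `A` is authorized, complete and eligible. -/
def Valid (I : APEPInstance) (A : Finset (Fin I.n × Fin I.k)) : Prop :=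
  A ⊆ I.base ∧ Complete A ∧ ∀ c ∈ I.constraints, Satisfies A c

open scoped Classical in
/-- An unweighted constraint as a weighted one: weight `0` if it is satisfied, `1` if not. -/
noncomputable def violation {n k : ℕ} (c : DecisionCircuit (Fin n × Fin k))
    (A : Finset (Fin n × Fin k)) : ℕ :=
  if Satisfies A c then 0 else 1

/-- The set of constraints is `t`-wbounded. -/
def IsWBounded (I : APEPInstance) (t : ℕ) : Prop :=
  WBounded t (I.constraints.map violation)

/-- Every constraint is `t`-bounded. -/
def AllBounded (I : APEPInstance) (t : ℕ) : Prop :=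
  ∀ c ∈ I.constraints, Bounded t fun A => Satisfies A c

/-- A binary word for an instance: `n`, `k`, the table of the base authorization relation, and
the constraints. -/
def word (I : APEPInstance) : List Bool :=
  natWord I.n ++ natWord I.k ++
    (List.finRange I.n).flatMap
      (fun u => (List.finRange I.k).map fun r => decide ((u, r) ∈ I.base)) ++
    listWord (fun c => c.word fun p => natWord p.1.val ++ natWord p.2.val) I.constraints

end APEPInstance

/-- APEP, parameterized by the number `k` of resources: is there a valid authorization relation? -/
def apep : ParamProblem where
  Inst := APEPInstance
  encode I := I.word
  param I := I.k
  Yes I := ∃ A, I.Valid A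

/-! ### Valued APEP -/

/-- The weighted constraint that is presented by a circuit whose output gates give the binary digits
of the weight. -/
def constraintWeight {n k : ℕ} (c : Circuit (Fin n × Fin k)) (A : Finset (Fin n × Fin k)) : ℕ :=
  c.number fun p => decide (p ∈ A)

/-- An instance of (the decision version of) Valued APEP. The weights `ω u T`, for each user `u`,
are presented by a circuit with one variable for each resource, which tells whether this resource
belongs to `T`. -/
structure ValuedAPEPInstance where
  n : ℕ
  k : ℕ
  constraints : List (Circuit (Fin n × Fin k))
  userCircuit : Fin n → Circuit (Fin k)
  isUserWeight : IsUserWeight fun u T => (userCircuit u).number fun r => decide (r ∈ T)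
  budget : ℕ

namespace ValuedAPEPInstance

/-- The weighted user authorization function `ω`. -/
def userWeight (I : ValuedAPEPInstance) (u : Fin I.n) (T : Finset (Fin I.k)) : ℕ :=
  (I.userCircuit u).number fun r => decide (r ∈ T)

/-- The weight `w(A) = Ω(A) + w_C(A)`. -/
def weight (I : ValuedAPEPInstance) (A : Finset (Fin I.n × Fin I.k)) : ℕ :=
  (∑ u, I.userWeight u (resourcesOf A u)) + totalWeight (I.constraints.map constraintWeight) A

/-- The set of weighted constraints is `t`-wbounded. -/
def IsWBounded (I : ValuedAPEPInstance) (t : ℕ) : Prop :=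
  WBounded t (I.constraints.map constraintWeight)

/-- Every weighted constraint is `t`-bounded. -/
def AllBounded (I : ValuedAPEPInstance) (t : ℕ) : Prop :=
  ∀ c ∈ I.constraints, BoundedWeight t (constraintWeight c)

/-- A binary word for an instance: `n`, `k`, the constraints, the circuits for the users,
and the budget. -/
def word (I : ValuedAPEPInstance) : List Bool :=
  natWord I.n ++ natWord I.k ++
    listWord (fun c => c.word fun p => natWord p.1.val ++ natWord p.2.val) I.constraints ++
    (List.finRange I.n).flatMap
      (fun u => (I.userCircuit u).word fun r => natWord r.val) ++
    binaryWord I.budget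

end ValuedAPEPInstance

/-- The decision version of Valued APEP, parameterized by the number `k` of resources: is there a
complete authorization relation of weight at most the budget? -/
def valuedAPEP : ParamProblem where
  Inst := ValuedAPEPInstance
  encode I := I.word
  param I := I.k
  Yes I := ∃ A : Finset (Fin I.n × Fin I.k), Complete A ∧ I.weight A ≤ I.budget

end ParamAPEP

/-! Call a relation sparse if no two of its pairs share a user or a resource. A sparse relation is
the graph of an injective partial map from resources to users, and completeness makes this map
total. So the users of a complete sparse relation form a set of exactly `k` elements, and every
`k`-element set of users arises in this way. This encodes the condition "exactly `κ` variables are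
true": the variables of a given circuit become the users, there are `κ` resources, and the only
constraint says that the relation is sparse and that the circuit accepts the set of its users
(`SparseAccepts`, `exists_sparseAccepts_iff`). Constraints are presented by circuits, so
polynomially many extra gates around the given circuit are enough. For Valued APEP the negated
output serves as a 0/1 weight, the user weights vanish and the budget is `0`.

Boundedness is a consequence of sparsity. A relation that satisfies the constraint has at most `k`
pairs, hence at most `k` users, and deleting any other user changes nothing. A complete relation
that violates the constraint already has the largest weight, so only completeness has to be
preserved, and one user for each resource guarantees that (`bounded_of_sparse`,
`boundedWeight_of_sparse`, `wBounded_of_sparse`).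

The remaining work is the Turing machine. A problem in W[1] comes with a machine that writes an
instance of weighted circuit satisfiability. Programs in the language `Cmd` are compiled to machine
code (`stepsTo_code`), and such code is run after the given machine (`Reduces.then_program`). The
intermediate word is at most the input length plus a constant times the running time, so a
polynomial-time program keeps the total time within the bound for parameterized reductions. The
predicate `Emits` records what a program writes and how long it takes; `reduces_of_emits` combines
all this. The unrestricted statements follow from the restricted ones. -/

namespace ParamAPEP

/-! ### Stack programs as machine code, and their composition with parameterized reductions -/

open Turing Function

/-! ### Step counting for stack machines -/

section StepsTo

variable {K : Type} [DecidableEq K] {Γ : K → Type} {Λ σ : Type}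

/-- The machine `M` goes from `a` to `b` in exactly `n` steps. -/
def StepsTo (M : Λ → TM2.Stmt Γ Λ σ) (n : ℕ) (a b : TM2.Cfg Γ Λ σ) : Prop :=
  (flip bind (TM2.step M))^[n] (some a) = some b

theorem StepsTo.refl (M : Λ → TM2.Stmt Γ Λ σ) (a) : StepsTo M 0 a a := rfl

theorem StepsTo.trans {M : Λ → TM2.Stmt Γ Λ σ} {m n : ℕ} {a b c} (h₁ : StepsTo M m a b)
    (h₂ : StepsTo M n b c) : StepsTo M (m + n) a c := by
  unfold StepsTo at *
  rw [Nat.add_comm, Function.iterate_add_apply, h₁, h₂]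

theorem StepsTo.head {M : Λ → TM2.Stmt Γ Λ σ} {n : ℕ} {a b c} (h₁ : TM2.step M a = some b)
    (h₂ : StepsTo M n b c) : StepsTo M (1 + n) a c :=
  StepsTo.trans (m := 1) (by simpa [StepsTo, flip] using h₁) h₂

theorem StepsTo.cases_succ {M : Λ → TM2.Stmt Γ Λ σ} {n : ℕ} {a c} (h : StepsTo M (n + 1) a c) :
    ∃ b, TM2.step M a = some b ∧ StepsTo M n b c := by
  unfold StepsTo at *
  rw [Function.iterate_succ_apply] at h
  cases hb : TM2.step M a with
  | some b =>
    refine ⟨b, rfl, ?_⟩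
    simpa [flip, hb] using h
  | none =>
    exfalso
    -- `none` is absorbing, so a computation that has stopped never reaches `some c`.
    have hn : ∀ m, (flip bind (TM2.step M))^[m] (none : Option (TM2.Cfg Γ Λ σ)) = none := by
      intro m
      induction m with
      | zero => rfl
      | succ m ih => rw [Function.iterate_succ_apply]; exact ih
    have h' : (flip bind (TM2.step M))^[n] (none : Option (TM2.Cfg Γ Λ σ)) = some c := by
      simpa [flip, hb] using h
    rw [hn] at h'
    cases h'

/-- The number of symbols that a statement can push. -/
def pushCount : TM2.Stmt Γ Λ σ → ℕ
  | .push _ _ q => pushCount q + 1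
  | .peek _ _ q => pushCount q
  | .pop _ _ q => pushCount q
  | .load _ q => pushCount q
  | .branch _ q₁ q₂ => pushCount q₁ + pushCount q₂
  | .goto _ => 0
  | .halt => 0

theorem length_stepAux_le (q : TM2.Stmt Γ Λ σ) (v : σ) (S : ∀ k, List (Γ k)) (k : K) :
    ((TM2.stepAux q v S).stk k).length ≤ (S k).length + pushCount q := by
  induction q generalizing v S with
  | push k' f q ih =>
    refine (ih _ _).trans ?_
    by_cases h : k = k'
    · subst h; simp [pushCount, Nat.add_assoc, Nat.add_comm]
    · simp only [pushCount, update_of_ne h]; omega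
  | peek k' f q ih => exact ih _ _
  | pop k' f q ih =>
    refine (ih _ _).trans ?_
    by_cases h : k = k'
    · subst h; simp [pushCount]
    · simp [pushCount, h]
  | load a q ih => exact ih _ _
  | branch f q₁ q₂ ih₁ ih₂ =>
    simp only [TM2.stepAux, pushCount]
    cases f v
    · have := ih₂ v S; simp only [cond]; omega
    · have := ih₁ v S; simp only [cond]; omega
  | goto f => simp [pushCount]
  | halt => simp [pushCount]

/-- One step executes one statement, and the sum of `pushCount` over all labels bounds the pushes of
each of them. This turns a time bound for a machine into a length bound for its output, on which the
program that follows has to run. -/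
theorem StepsTo.length_le [Fintype Λ] {M : Λ → TM2.Stmt Γ Λ σ} {n : ℕ} {a b}
    (h : StepsTo M n a b) (k : K) :
    (b.stk k).length ≤ (a.stk k).length + n * ∑ l, pushCount (M l) := by
  induction n generalizing a with
  | zero =>
    have : a = b := Option.some.inj h
    simp [this]
  | succ n ih =>
    obtain ⟨c, hc, hn⟩ := h.cases_succ
    refine (ih hn).trans ?_
    obtain ⟨l, v, S⟩ := a
    cases l with
    | none => cases hc
    | some l =>
      have hc : TM2.stepAux (M l) v S = c := Option.some.inj hc
      have h1 := length_stepAux_le (M l) v S k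
      have h2 : pushCount (M l) ≤ ∑ l, pushCount (M l) :=
        Finset.single_le_sum (f := fun l => pushCount (M l)) (fun _ _ => Nat.zero_le _)
          (Finset.mem_univ l)
      rw [hc] at h1
      simp only [Nat.succ_mul]
      omega

end StepsTo

/-! ### A language of stack programs -/

/-- Programs that work on stacks of bits. -/
inductive Cmd (K : Type) : Type
  | skip
  | push (k : K) (b : Bool)
  | pour (k k' : K)
  | seq (c d : Cmd K)
  | ifpop (k : K) (c d : Cmd K)
  | loop (k : K) (c : Cmd K)

namespace Cmd

variable {K : Type}

/-- The labels of the machine code for a program. -/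
def Lab : Cmd K → Type
  | skip => Unit
  | push _ _ => Unit
  | pour _ _ => Unit
  | seq c d => c.Lab ⊕ d.Lab
  | ifpop _ c d => Option (c.Lab ⊕ d.Lab)
  | loop _ c => Option c.Lab

/-- The first label of a program. -/
def entry : (c : Cmd K) → c.Lab
  | skip => ()
  | push _ _ => ()
  | pour _ _ => ()
  | seq c _ => Sum.inl c.entry
  | ifpop _ _ _ => none
  | loop _ _ => none

instance instFintypeLab : (c : Cmd K) → Fintype c.Lab
  | skip => inferInstanceAs (Fintype Unit)
  | push _ _ => inferInstanceAs (Fintype Unit)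
  | pour _ _ => inferInstanceAs (Fintype Unit)
  | seq c d =>
    letI := instFintypeLab c
    letI := instFintypeLab d
    inferInstanceAs (Fintype (c.Lab ⊕ d.Lab))
  | ifpop _ c d =>
    letI := instFintypeLab c
    letI := instFintypeLab d
    inferInstanceAs (Fintype (Option (c.Lab ⊕ d.Lab)))
  | loop _ c =>
    letI := instFintypeLab c
    inferInstanceAs (Fintype (Option c.Lab))

/-- `Runs c S t S'`: the program `c` turns the stacks `S` into `S'` in `t` steps. The command
`ifpop` pops a bit and branches, `loop` pops a bit before each iteration and goes on as long as
this bit is `true`. -/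
inductive Runs [DecidableEq K] : Cmd K → (K → List Bool) → ℕ → (K → List Bool) → Prop
  | skip (S) : Runs skip S 1 S
  | push (k b S) : Runs (push k b) S 1 (update S k (b :: S k))
  | pour_nil (k k' S) : S k = [] → Runs (pour k k') S 1 (update S k [])
  | pour_cons (k k' S t S' b l) : S k = b :: l →
      Runs (pour k k') (update (update S k l) k' (b :: update S k l k')) t S' →
      Runs (pour k k') S (1 + t) S'
  | seq {c d S t S' t' S''} : Runs c S t S' → Runs d S' t' S'' → Runs (seq c d) S (t + t') S''
  | ifpop_true {k c d S t S'} : (S k).head? = some true →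
      Runs c (update S k (S k).tail) t S' → Runs (ifpop k c d) S (1 + t) S'
  | ifpop_false {k c d S t S'} : (S k).head? ≠ some true →
      Runs d (update S k (S k).tail) t S' → Runs (ifpop k c d) S (1 + t) S'
  | loop_true {k c S t S' t' S''} : (S k).head? = some true →
      Runs c (update S k (S k).tail) t S' → Runs (loop k c) S' t' S'' →
      Runs (loop k c) S (1 + (t + t')) S''
  | loop_false {k c S} : (S k).head? ≠ some true → Runs (loop k c) S 1 (update S k (S k).tail)

/-! ### Machine code -/

section Code

variable {K₁ : Type} {Γ₁ : K₁ → Type} {L σ₁ : Type}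

/-- The stack alphabets of a machine with the stacks of a given machine and stacks of bits. -/
abbrev Alph (K : Type) (Γ₁ : K₁ → Type) (k : K₁ ⊕ K) : Type :=
  match k with
  | Sum.inl k => Γ₁ k
  | Sum.inr _ => Bool

/-- The machine code for a program: `emb` embeds its labels into those of the machine, and the
machine goes to `exit` when the program is done. -/
def code : (c : Cmd K) → (c.Lab → L) → L → c.Lab → TM2.Stmt (Alph K Γ₁) L (σ₁ × Option Bool)
  | skip, _, exit => fun _ => .goto fun _ => exit
  | push k b, _, exit => fun _ => .push (Sum.inr k) (fun _ => b) (.goto fun _ => exit)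
  | pour k k', emb, exit => fun _ =>
    -- The popped bit is kept in the second component of the state; `none` there means that the
    -- stack was empty, which ends the pouring.
    .pop (Sum.inr k) (fun v o => (v.1, o))
      (.branch (fun v => v.2.isSome)
        (.push (Sum.inr k') (fun v => v.2.getD false) (.goto fun _ => emb ()))
        (.goto fun _ => exit))
  | seq c d, emb, exit => fun l =>
    match l with
    | Sum.inl l => code c (fun l => emb (Sum.inl l)) (emb (Sum.inr d.entry)) l
    | Sum.inr l => code d (fun l => emb (Sum.inr l)) exit l
  | ifpop k c d, emb, exit => fun l =>
    match l with
    | none => .pop (Sum.inr k) (fun v o => (v.1, o))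
        (.branch (fun v => v.2 == some true)
          (.goto fun _ => emb (some (Sum.inl c.entry)))
          (.goto fun _ => emb (some (Sum.inr d.entry))))
    | some (Sum.inl l) => code c (fun l => emb (some (Sum.inl l))) exit l
    | some (Sum.inr l) => code d (fun l => emb (some (Sum.inr l))) exit l
  | loop k c, emb, exit => fun l =>
    match l with
    | none => .pop (Sum.inr k) (fun v o => (v.1, o))
        (.branch (fun v => v.2 == some true)
          (.goto fun _ => emb (some c.entry))
          (.goto fun _ => exit))
    | some l => code c (fun l => emb (some l)) (emb none) l

/-- The stacks of two machines side by side. -/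
def joinStacks (T : ∀ k, List (Γ₁ k)) (S : K → List Bool) : ∀ k, List (Alph K Γ₁ k)
  | Sum.inl k => T k
  | Sum.inr k => S k

variable [DecidableEq K₁] [DecidableEq K]

theorem update_joinStacks_inl (T : ∀ k, List (Γ₁ k)) (S : K → List Bool) (k : K₁)
    (l : List (Γ₁ k)) :
    update (β := fun k => List (Alph K Γ₁ k)) (joinStacks T S) (Sum.inl k) l =
      joinStacks (update T k l) S := by
  funext j
  rcases j with j | j
  · by_cases h : j = k
    · subst h
      simp [joinStacks]
    · simp [joinStacks, h]
  · simp [joinStacks]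

theorem update_joinStacks_inr (T : ∀ k, List (Γ₁ k)) (S : K → List Bool) (k : K)
    (l : List Bool) :
    update (β := fun k => List (Alph K Γ₁ k)) (joinStacks T S) (Sum.inr k) l =
      joinStacks T (update S k l) := by
  funext j
  rcases j with j | j
  · simp [joinStacks]
  · by_cases h : j = k
    · subst h
      simp [joinStacks]
    · simp [joinStacks, h]

theorem stepAux_pop_inr (T : ∀ k, List (Γ₁ k)) (S : K → List Bool) (k : K) (s : σ₁)
    (v : Option Bool) (q : TM2.Stmt (Alph K Γ₁) L (σ₁ × Option Bool)) :
    TM2.stepAux (.pop (Sum.inr k) (fun v o => (v.1, o)) q) (s, v) (joinStacks T S) =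
      TM2.stepAux q (s, (S k).head?) (joinStacks T (update S k (S k).tail)) := by
  rw [← update_joinStacks_inr]
  rfl

theorem stepAux_pop_inl (T : ∀ k, List (Γ₁ k)) (S : K → List Bool) (k : K₁) (s : σ₁)
    (v : Option Bool) (f : Γ₁ k → Bool) (q : TM2.Stmt (Alph K Γ₁) L (σ₁ × Option Bool)) :
    TM2.stepAux (.pop (Sum.inl k) (fun v o => (v.1, o.map f)) q) (s, v) (joinStacks T S) =
      TM2.stepAux q (s, (T k).head?.map f) (joinStacks (update T k (T k).tail) S) := by
  rw [← update_joinStacks_inl]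
  rfl

theorem stepAux_push_inr (T : ∀ k, List (Γ₁ k)) (S : K → List Bool) (k : K)
    (f : σ₁ × Option Bool → Bool) (v : σ₁ × Option Bool)
    (q : TM2.Stmt (Alph K Γ₁) L (σ₁ × Option Bool)) :
    TM2.stepAux (.push (Sum.inr k) f q) v (joinStacks T S) =
      TM2.stepAux q v (joinStacks T (update S k (f v :: S k))) := by
  rw [← update_joinStacks_inr]
  rfl

theorem step_of_eq {M : L → TM2.Stmt (Alph K Γ₁) L (σ₁ × Option Bool)} {l q} (h : M l = q)
    (v S) : TM2.step M ⟨some l, v, S⟩ = some (TM2.stepAux q v S) := by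
  rw [TM2.step, h]

/-- Induction on the run; each rule of `Runs` charges one unit per visited label, so the step counts
agree exactly. The embedding and the exit are general because subprograms sit at different places of
the code. The bit register may start with any value, and its final value does not matter. -/
theorem stepsTo_code {M : L → TM2.Stmt (Alph K Γ₁) L (σ₁ × Option Bool)} (s : σ₁)
    (T : ∀ k, List (Γ₁ k)) {c : Cmd K} {S t S'} (h : Runs c S t S') :
    ∀ (emb : c.Lab → L) (exit : L) (_ : ∀ l, M (emb l) = c.code emb exit l) (v : Option Bool),
      ∃ v', StepsTo M t ⟨some (emb c.entry), (s, v), joinStacks T S⟩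
        ⟨some exit, (s, v'), joinStacks T S'⟩ := by
  induction h with
  | skip S =>
    intro emb exit hM v
    exact ⟨v, StepsTo.head (step_of_eq (hM _) _ _) (StepsTo.refl _ _)⟩
  | push k b S =>
    intro emb exit hM v
    refine ⟨v, StepsTo.head ((step_of_eq (hM _) _ _).trans (congrArg some ?_)) (StepsTo.refl _ _)⟩
    exact stepAux_push_inr T S k _ _ _
  | pour_nil k k' S hk =>
    intro emb exit hM v
    refine ⟨none, StepsTo.head ((step_of_eq (hM _) _ _).trans (congrArg some ?_)) (StepsTo.refl _ _)⟩
    refine (stepAux_pop_inr T S k s v _).trans ?_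
    rw [hk]
    rfl
  | pour_cons k k' S t S' b l hk _ ih =>
    intro emb exit hM v
    obtain ⟨v', h'⟩ := ih emb exit hM (some b)
    refine ⟨v', StepsTo.head ((step_of_eq (hM _) _ _).trans (congrArg some ?_)) h'⟩
    refine (stepAux_pop_inr T S k s v _).trans ?_
    rw [hk]
    exact Eq.trans (b := TM2.stepAux (.push (Sum.inr k') (fun v => v.2.getD false)
      (.goto fun _ => emb ())) (s, some b) (joinStacks T (update S k l))) rfl
      (stepAux_push_inr T _ k' _ _ _)
  | seq _ _ ih₁ ih₂ =>
    intro emb exit hM v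
    obtain ⟨v₁, h₁⟩ := ih₁ (fun l => emb (Sum.inl l)) _ (fun l => hM (Sum.inl l)) v
    obtain ⟨v₂, h₂⟩ := ih₂ (fun l => emb (Sum.inr l)) _ (fun l => hM (Sum.inr l)) v₁
    exact ⟨v₂, h₁.trans h₂⟩
  | @ifpop_true k c d S t S' hk _ ih =>
    intro emb exit hM v
    obtain ⟨v', h'⟩ := ih (fun l => emb (some (Sum.inl l))) exit
      (fun l => hM (some (Sum.inl l))) (some true)
    refine ⟨v', StepsTo.head ((step_of_eq (hM none) _ _).trans (congrArg some ?_)) h'⟩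
    refine (stepAux_pop_inr T S k s v _).trans ?_
    rw [hk]
    rfl
  | @ifpop_false k c d S t S' hk _ ih =>
    intro emb exit hM v
    obtain ⟨v', h'⟩ := ih (fun l => emb (some (Sum.inr l))) exit
      (fun l => hM (some (Sum.inr l))) (S k).head?
    refine ⟨v', StepsTo.head ((step_of_eq (hM none) _ _).trans (congrArg some ?_)) h'⟩
    refine (stepAux_pop_inr T S k s v _).trans ?_
    rw [TM2.stepAux]
    simp only [beq_eq_false_iff_ne.mpr hk]
    rfl
  | @loop_true k c S t S' t' S'' hk _ _ ih₁ ih₂ =>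
    intro emb exit hM v
    obtain ⟨v₁, h₁⟩ := ih₁ (fun l => emb (some l)) (emb none) (fun l => hM (some l)) (some true)
    obtain ⟨v₂, h₂⟩ := ih₂ emb exit hM v₁
    refine ⟨v₂, StepsTo.head ((step_of_eq (hM none) _ _).trans (congrArg some ?_)) (h₁.trans h₂)⟩
    refine (stepAux_pop_inr T S k s v _).trans ?_
    rw [hk]
    rfl
  | @loop_false k c S hk =>
    intro emb exit hM v
    refine ⟨(S k).head?, StepsTo.head ((step_of_eq (hM none) _ _).trans (congrArg some ?_)) (StepsTo.refl _ _)⟩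
    refine (stepAux_pop_inr T S k s v _).trans ?_
    rw [TM2.stepAux]
    simp only [beq_eq_false_iff_ne.mpr hk]
    rfl

/-- The code of a given machine as a part of a larger machine, which goes to `exit` when the given
machine halts. -/
def liftStmt {Λ₁ : Type} (emb : Λ₁ → L) (exit : L) :
    TM2.Stmt Γ₁ Λ₁ σ₁ → TM2.Stmt (Alph K Γ₁) L (σ₁ × Option Bool)
  | .push k f q => .push (Sum.inl k) (fun v => f v.1) (liftStmt emb exit q)
  | .peek k f q => .peek (Sum.inl k) (fun v o => (f v.1 o, v.2)) (liftStmt emb exit q)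
  | .pop k f q => .pop (Sum.inl k) (fun v o => (f v.1 o, v.2)) (liftStmt emb exit q)
  | .load a q => .load (fun v => (a v.1, v.2)) (liftStmt emb exit q)
  | .branch f q₁ q₂ => .branch (fun v => f v.1) (liftStmt emb exit q₁) (liftStmt emb exit q₂)
  | .goto f => .goto fun v => emb (f v.1)
  | .halt => .goto fun _ => exit

/-- A configuration of a given machine as a configuration of a larger machine. -/
def liftCfg {Λ₁ : Type} (emb : Λ₁ → L) (exit : L) (x : Option Bool) (S : K → List Bool)
    (a : TM2.Cfg Γ₁ Λ₁ σ₁) : TM2.Cfg (Alph K Γ₁) L (σ₁ × Option Bool) :=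
  ⟨some (a.l.elim exit emb), (a.var, x), joinStacks a.stk S⟩

theorem stepAux_liftStmt {Λ₁ : Type} (emb : Λ₁ → L) (exit : L) (x : Option Bool)
    (S : K → List Bool) (q : TM2.Stmt Γ₁ Λ₁ σ₁) (v : σ₁) (T : ∀ k, List (Γ₁ k)) :
    TM2.stepAux (liftStmt emb exit q) (v, x) (joinStacks T S) =
      liftCfg emb exit x S (TM2.stepAux q v T) := by
  induction q generalizing v T with
  | push k f q ih =>
    rw [TM2.stepAux, ← ih, ← update_joinStacks_inl]
    rfl
  | peek k f q ih => exact ih _ _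
  | pop k f q ih =>
    rw [TM2.stepAux, ← ih, ← update_joinStacks_inl]
    rfl
  | load a q ih => exact ih _ _
  | branch f q₁ q₂ ih₁ ih₂ =>
    simp only [liftStmt, TM2.stepAux]
    cases f v
    · exact ih₂ v T
    · exact ih₁ v T
  | goto f => rfl
  | halt => rfl

/-- `halt` is replaced by a jump within the same statement, so no step is gained or lost, and
`liftCfg` places a halted configuration at `exit`. -/
theorem stepsTo_lift {Λ₁ : Type} {M₁ : Λ₁ → TM2.Stmt Γ₁ Λ₁ σ₁}
    {M : L → TM2.Stmt (Alph K Γ₁) L (σ₁ × Option Bool)} {emb : Λ₁ → L} {exit : L}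
    (hM : ∀ l, M (emb l) = liftStmt emb exit (M₁ l)) (x : Option Bool) (S : K → List Bool)
    {n : ℕ} {a b : TM2.Cfg Γ₁ Λ₁ σ₁} (h : StepsTo M₁ n a b) :
    StepsTo M n (liftCfg emb exit x S a) (liftCfg emb exit x S b) := by
  induction n generalizing a with
  | zero =>
    have : a = b := Option.some.inj h
    rw [this]; exact StepsTo.refl _ _
  | succ n ih =>
    obtain ⟨c, hc, hn⟩ := h.cases_succ
    rw [Nat.add_comm]
    refine StepsTo.head ?_ (ih hn)
    obtain ⟨l, v, T⟩ := a
    cases l with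
    | none => cases hc
    | some l =>
      have hc : TM2.stepAux (M₁ l) v T = c := Option.some.inj hc
      rw [← hc, ← stepAux_liftStmt, ← hM]
      rfl

end Code

end Cmd

/-! ### A machine followed by a program -/

section Compose

variable {K : Type} [DecidableEq K] [Fintype K]

/-- Labels for a machine followed by a program. -/
abbrev ThenLab (M₁ : FinTM2) (c : Cmd K) : Type := M₁.Λ ⊕ (Bool ⊕ c.Lab)

/-- Runs a given machine, moves its output to the stack `io`, in reverse order, and runs a program
that leaves its output on the same stack. -/
def thenProgram (M : TM2ComputableAux Bool Bool) (c : Cmd K) (io : K) : FinTM2 :=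
  letI := M.tm.kDecidableEq
  letI := M.tm.kFin
  letI := M.tm.ΛFin
  letI := M.tm.σFin
  letI := M.tm.Γk₀Fin
  { K := M.tm.K ⊕ K
    k₀ := Sum.inl M.tm.k₀
    k₁ := Sum.inr io
    Γ := Cmd.Alph K M.tm.Γ
    Λ := ThenLab M.tm c
    main := Sum.inl M.tm.main
    σ := M.tm.σ × Option Bool
    initialState := (M.tm.initialState, none)
    Γk₀Fin := M.tm.Γk₀Fin
    m := fun l =>
      match l with
      | Sum.inl l => Cmd.liftStmt Sum.inl (Sum.inr (Sum.inl false)) (M.tm.m l)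
      | Sum.inr (Sum.inl false) =>
        .pop (Sum.inl M.tm.k₁) (fun v o => (v.1, o.map M.outputAlphabet))
          (.branch (fun v => v.2.isSome)
            (.push (Sum.inr io) (fun v => v.2.getD false)
              (.goto fun _ => Sum.inr (Sum.inl false)))
            (.goto fun _ => Sum.inr (Sum.inr c.entry)))
      -- `haltList` asks for the initial state, hence the bit register is reset before halting.
      | Sum.inr (Sum.inl true) => .load (fun v => (v.1, none)) .halt
      | Sum.inr (Sum.inr l) =>
        c.code (fun l => Sum.inr (Sum.inr l)) (Sum.inr (Sum.inl true)) l }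

/-- The four summands are the run of the given machine, the transfer of its output (one step per
symbol and one to notice the end), the program, and the final reset. -/
theorem outputsInTime_thenProgram (M : TM2ComputableAux Bool Bool) (c : Cmd K) (io : K)
    {w u v : List Bool} {t₁ t₂ : ℕ}
    (h₁ : Nonempty (TM2OutputsInTime M.tm (w.map M.inputAlphabet.symm)
      (some (u.map M.outputAlphabet.symm)) t₁))
    (h₂ : ∃ t ≤ t₂, c.Runs (update (fun _ => []) io u.reverse) t (update (fun _ => []) io v)) :
    Nonempty (TM2OutputsInTime (thenProgram M c io) (w.map M.inputAlphabet.symm)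
      (some v) (t₁ + (u.length + 1) + t₂ + 1)) := by
  obtain ⟨⟨⟨n₁, hn₁⟩, hle⟩⟩ := h₁
  replace hle : n₁ ≤ t₁ := hle
  obtain ⟨t, ht, hrun⟩ := h₂
  have hlift := Cmd.stepsTo_lift (K := K) (L := ThenLab M.tm c) (M₁ := M.tm.m)
    (M := (thenProgram M c io).m) (emb := Sum.inl) (exit := Sum.inr (Sum.inl false))
    (fun _ => rfl) none (fun _ => []) hn₁
  have hinit : initList (thenProgram M c io) (w.map M.inputAlphabet.symm) =
      Cmd.liftCfg (L := ThenLab M.tm c) Sum.inl (Sum.inr (Sum.inl false)) none (fun _ : K => [])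
        (initList M.tm (w.map M.inputAlphabet.symm)) := by
    have hstk : (initList (thenProgram M c io) (w.map M.inputAlphabet.symm)).stk =
        Cmd.joinStacks (initList M.tm (w.map M.inputAlphabet.symm)).stk (fun _ : K => []) := by
      funext j
      rcases j with j | j
      · by_cases h : j = M.tm.k₀
        · subst h
          simp [initList, Cmd.joinStacks, thenProgram]
          rfl
        · simp [initList, Cmd.joinStacks, thenProgram, h]
      · simp [initList, Cmd.joinStacks, thenProgram]
    exact congrArg (TM2.Cfg.mk _ _) hstk
  have hhalt : haltList (thenProgram M c io) v =
      ⟨none, (M.tm.initialState, none),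
        Cmd.joinStacks (fun _ => []) (update (fun _ : K => []) io v)⟩ := by
    have hstk : (haltList (thenProgram M c io) v).stk =
        Cmd.joinStacks (fun _ => []) (update (fun _ : K => []) io v) := by
      funext j
      rcases j with j | j
      · simp [haltList, Cmd.joinStacks, thenProgram]
      · by_cases h : j = io
        · subst h
          simp [haltList, Cmd.joinStacks, thenProgram]
          rfl
        · simp [haltList, Cmd.joinStacks, thenProgram, h]
    exact congrArg (TM2.Cfg.mk _ _) hstk
  have hstk : ∀ l, (haltList M.tm l).stk = update (fun _ => []) M.tm.k₁ l := by
    intro l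
    funext j
    by_cases h : j = M.tm.k₁
    · subst h
      simp [haltList]
    · simp [haltList, h]
  -- The transfer loop, for an arbitrary content `S` of the target. Moving symbols between stacks
  -- reverses the word, which is why the program starts with `u.reverse`.
  have htrans : ∀ (u : List Bool) (x : Option Bool) (S : List Bool),
      ∃ x', StepsTo (thenProgram M c io).m (u.length + 1)
      ⟨some (Sum.inr (Sum.inl false)), (M.tm.initialState, x), Cmd.joinStacks
        (update (fun _ => []) M.tm.k₁ (u.map M.outputAlphabet.symm))
        (update (fun _ : K => []) io S)⟩
      ⟨some (Sum.inr (Sum.inr c.entry)), (M.tm.initialState, x'),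
        Cmd.joinStacks (fun _ => []) (update (fun _ : K => []) io (u.reverse ++ S))⟩ := by
    intro u
    induction u with
    | nil =>
      intro x S
      refine ⟨none, ?_⟩
      rw [List.length_nil, Nat.add_comm]
      refine StepsTo.head (congrArg some ?_) (StepsTo.refl _ _)
      refine (Cmd.stepAux_pop_inl _ _ _ _ _ _ _).trans ?_
      simp only [List.map_nil, update_self, List.head?, List.tail, update_idem]
      rw [update_eq_self M.tm.k₁ (fun k : M.tm.K => ([] : List (M.tm.Γ k)))]
      rfl
    | cons b u ih =>
      intro x S
      obtain ⟨x', hx'⟩ := ih (some b) (b :: S)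
      refine ⟨x', ?_⟩
      rw [List.length_cons, List.reverse_cons, List.append_assoc, Nat.add_comm _ 1]
      refine StepsTo.head (congrArg some ?_) hx'
      refine (Cmd.stepAux_pop_inl _ _ _ _ _ _ _).trans ?_
      simp only [List.map_cons, update_self, List.head?, List.tail, update_idem, Option.map,
        Equiv.apply_symm_apply]
      refine Eq.trans (b := TM2.stepAux (.push (Sum.inr io) (fun v => v.2.getD false)
        (.goto fun _ => Sum.inr (Sum.inl false))) (M.tm.initialState, some b) (Cmd.joinStacks
        (update (fun _ => []) M.tm.k₁ (u.map M.outputAlphabet.symm))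
        (update (fun _ : K => []) io S))) rfl ?_
      refine (Cmd.stepAux_push_inr _ _ io _ _ _).trans ?_
      simp only [update_self, update_idem]
      rfl
  obtain ⟨x, hx⟩ := htrans u none []
  obtain ⟨y, hy⟩ := Cmd.stepsTo_code (L := ThenLab M.tm c) (M := (thenProgram M c io).m)
    M.tm.initialState (fun _ => []) hrun (fun l => Sum.inr (Sum.inr l)) (Sum.inr (Sum.inl true))
    (fun _ => rfl) x
  rw [List.append_nil] at hx
  rw [update_eq_self io (fun _ : K => ([] : List Bool)), ← hstk] at hx
  have hlast : StepsTo (thenProgram M c io).m 1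
      ⟨some (Sum.inr (Sum.inl true)), (M.tm.initialState, y),
        Cmd.joinStacks (fun _ => []) (update (fun _ : K => []) io v)⟩
      (haltList (thenProgram M c io) v) := by
    rw [hhalt]
    rfl
  rw [← hinit] at hlift
  exact ⟨⟨⟨_, ((hlift.trans hx).trans hy).trans hlast⟩, by dsimp only; omega⟩⟩

theorem _root_.Computable.pow_const {h : ℕ → ℕ} (hh : Computable h) (e : ℕ) :
    Computable fun n => h n ^ e := by
  induction e with
  | zero => simpa using Computable.const 1
  | succ e ih =>
    simp only [pow_succ]
    exact Primrec.nat_mul.to_comp.comp ih hh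

namespace ParamProblem

theorem one_le_length_word (P : ParamProblem) (I : P.Inst) : 1 ≤ (P.word I).length := by
  simp [word, natWord]
  omega

/-- A parameterized reduction, followed by a program that runs in polynomial time. -/
theorem Reduces.then_program {P Q R : ParamProblem} (hPQ : P.Reduces Q) (c : Cmd K) (io : K)
    (f : Q.Inst → R.Inst) (hyes : ∀ I, Q.Yes I ↔ R.Yes (f I))
    (hparam : ∀ I, R.param (f I) ≤ Q.param I) (a e : ℕ)
    (hrun : ∀ I, ∃ t ≤ a * (Q.word I).length ^ e,
      c.Runs (update (fun _ => []) io (Q.word I).reverse) t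
        (update (fun _ => []) io (R.word (f I)))) : P.Reduces R := by
  obtain ⟨f₁, g, h, d, M, hg, hh, hyes₁, hparam₁, hM⟩ := hPQ
  let := M.tm.ΛFin
  set B := ∑ l, pushCount (M.tm.m l) with hB
  -- With `n` the input length and `H = h κ`, the intermediate word has length `m ≤ (1 + B * H) * n
  -- ^ (d + 1)`. The three summands pay for the given machine, for the overhead linear in `m`, and
  -- for the program; one exponent of `n` serves all of them.
  refine ⟨f ∘ f₁, g, fun κ => h κ + 3 * (1 + B * h κ) + a * (1 + B * h κ) ^ e,
    (d + 1) * (e + 1),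
    ⟨thenProgram M c io, M.inputAlphabet, Equiv.refl Bool⟩, hg, ?_,
    fun I => (hyes₁ I).trans (hyes _), fun I => (hparam _).trans (hparam₁ I), fun I => ?_⟩
  · have hZ : Computable fun κ => 1 + B * h κ :=
      Primrec.nat_add.to_comp.comp (Computable.const 1)
        (Primrec.nat_mul.to_comp.comp (Computable.const B) hh)
    exact Primrec.nat_add.to_comp.comp (Primrec.nat_add.to_comp.comp hh
      (Primrec.nat_mul.to_comp.comp (Computable.const 3) hZ))
      (Primrec.nat_mul.to_comp.comp (Computable.const a) (hZ.pow_const e))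
  · have hout := outputsInTime_thenProgram M c io (hM I) (hrun (f₁ I))
    have hlen : (Q.word (f₁ I)).length ≤
        (P.word I).length + h (P.param I) * (P.word I).length ^ d * B := by
      obtain ⟨⟨⟨n, hn⟩, hle⟩⟩ := hM I
      replace hle : n ≤ h (P.param I) * (P.word I).length ^ d := hle
      have h1 := StepsTo.length_le (M := M.tm.m) hn M.tm.k₁
      have h2 : ((haltList M.tm ((Q.word (f₁ I)).map M.outputAlphabet.symm)).stk M.tm.k₁).length =
          (Q.word (f₁ I)).length := by
        have : (haltList M.tm ((Q.word (f₁ I)).map M.outputAlphabet.symm)).stk M.tm.k₁ =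
            (Q.word (f₁ I)).map M.outputAlphabet.symm := by
          simp [haltList]
        rw [this, List.length_map]
      -- The output stack may or may not be the input stack, so the bound is shown for every stack.
      have h3 : ((initList M.tm ((P.word I).map M.inputAlphabet.symm)).stk M.tm.k₁).length ≤
          (P.word I).length := by
        have key : ∀ k, ((initList M.tm ((P.word I).map M.inputAlphabet.symm)).stk k).length ≤
            (P.word I).length := by
          intro k
          by_cases hk : k = M.tm.k₀
          · subst hk
            have : (initList M.tm ((P.word I).map M.inputAlphabet.symm)).stk M.tm.k₀ =
                (P.word I).map M.inputAlphabet.symm := by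
              simp [initList]
            rw [this, List.length_map]
          · simp [initList, hk]
        exact key _
      have h4 := Nat.mul_le_mul_right B hle
      rw [h2] at h1
      exact h1.trans (Nat.add_le_add h3 h4)
    obtain ⟨o⟩ := hout
    refine ⟨⟨⟨o.steps, ?_⟩, o.steps_le_m.trans ?_⟩⟩
    · have := o.evals_in_steps
      have hid : (R.word (f (f₁ I))).map (Equiv.refl Bool).symm = R.word (f (f₁ I)) := by simp
      exact this.trans (congrArg (fun l => Option.map (haltList (thenProgram M c io)) (some l))
        hid.symm)
    · dsimp only
      have h1 := P.one_le_length_word I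
      have h5 := Q.one_le_length_word (f₁ I)
      generalize (P.word I).length = n at *
      generalize (Q.word (f₁ I)).length = m at *
      generalize h (P.param I) = H at *
      have hnd : n ^ d ≤ n ^ (d + 1) := Nat.pow_le_pow_right h1 (by omega)
      have hn1 : n ≤ n ^ (d + 1) := by
        exact Nat.le_self_pow (by omega) n
      have hm : m ≤ (1 + B * H) * n ^ (d + 1) := by
        calc m ≤ n + H * n ^ d * B := hlen
          _ ≤ n ^ (d + 1) + H * n ^ (d + 1) * B := by gcongr
          _ = _ := by ring
      have hN : n ^ (d + 1) ≤ n ^ ((d + 1) * (e + 1)) :=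
        Nat.pow_le_pow_right h1 (by nlinarith)
      have hNe : (n ^ (d + 1)) ^ e ≤ n ^ ((d + 1) * (e + 1)) := by
        rw [← pow_mul]
        exact Nat.pow_le_pow_right h1 (by nlinarith)
      have hme : m ^ e ≤ (1 + B * H) ^ e * n ^ ((d + 1) * (e + 1)) := by
        calc m ^ e ≤ ((1 + B * H) * n ^ (d + 1)) ^ e := Nat.pow_le_pow_left hm e
          _ = (1 + B * H) ^ e * (n ^ (d + 1)) ^ e := mul_pow _ _ _
          _ ≤ _ := Nat.mul_le_mul_left _ hNe
      -- The two extra steps are absorbed into `3 * m` because `1 ≤ m`.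
      calc H * n ^ d + (m + 1) + a * m ^ e + 1
          ≤ H * n ^ (d + 1) + 3 * m + a * m ^ e := by
            have := Nat.mul_le_mul_left H hnd
            omega
        _ ≤ H * n ^ ((d + 1) * (e + 1)) + 3 * ((1 + B * H) * n ^ ((d + 1) * (e + 1))) +
            a * ((1 + B * H) ^ e * n ^ ((d + 1) * (e + 1))) := by
            gcongr
            exact hm.trans (Nat.mul_le_mul_left _ hN)
        _ = _ := by ring

/-- A reduction to a restriction of a problem is a reduction to the problem. -/
theorem Reduces.of_restrict {P Q : ParamProblem} {p : Q.Inst → Prop}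
    (h : P.Reduces (Q.restrict p)) : P.Reduces Q := by
  obtain ⟨f, g, h, d, M, hg, hh, hyes, hparam, hM⟩ := h
  exact ⟨fun I => (f I).1, g, h, d, M, hg, hh, hyes, hparam, hM⟩

end ParamProblem

end Compose

end ParamAPEP

/-! ### The constraint circuit, its correctness and its boundedness -/

namespace ParamAPEP

/-! ### Values of gates -/

section GateFold

variable {ι α : Type}

theorem gateFold_concat (step : (ℕ → α) → Gate ι → α) (d : α) (gs : List (Gate ι)) (g : Gate ι) :
    gateFold step d (gs ++ [g]) =
      gateFold step d gs ++ [step (fun j => (gateFold step d gs).getD j d) g] := by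
  simp [gateFold, List.foldl_append]

theorem length_gateFold (step : (ℕ → α) → Gate ι → α) (d : α) (gs : List (Gate ι)) :
    (gateFold step d gs).length = gs.length := by
  induction gs using List.reverseRecOn with
  | nil => rfl
  | append_singleton gs g ih => rw [gateFold_concat]; simp [ih]

/-- Gates with the numbers `s, s + 1, …` refer to gates with smaller numbers only. -/
def RefersBack (s : ℕ) (gs : List (Gate ι)) : Prop :=
  ∀ i (g : Gate ι), gs[i]? = some g → ∀ j ∈ g.args, j < s + i

theorem RefersBack.append {s : ℕ} {gs gs' : List (Gate ι)} (h : RefersBack s gs)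
    (h' : RefersBack (s + gs.length) gs') : RefersBack s (gs ++ gs') := by
  intro i g hg j hj
  by_cases hi : i < gs.length
  · exact h i g (by rwa [List.getElem?_append_left hi] at hg) j hj
  · rw [List.getElem?_append_right (by omega)] at hg
    have := h' _ g hg j hj
    omega

theorem RefersBack.of_append {s : ℕ} {gs gs' : List (Gate ι)} (h : RefersBack s (gs ++ gs')) :
    RefersBack s gs := by
  intro i g hg
  have hi : i < gs.length := (List.getElem?_eq_some_iff.mp hg).1
  exact h i g (by rwa [List.getElem?_append_left hi])

theorem RefersBack.map_range {s n : ℕ} {f : ℕ → Gate ι}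
    (h : ∀ i < n, ∀ j ∈ (f i).args, j < s + i) : RefersBack s ((List.range n).map f) := by
  intro i g hg
  obtain ⟨hi, rfl⟩ := List.getElem?_eq_some_iff.mp hg
  simp only [List.length_map, List.length_range] at hi
  simpa using h i hi

theorem RefersBack.singleton {s : ℕ} {g : Gate ι} (h : ∀ j ∈ g.args, j < s) :
    RefersBack s [g] := by
  intro i g' hg
  obtain ⟨hi, rfl⟩ := List.getElem?_eq_some_iff.mp hg
  simp only [List.length_singleton, Nat.lt_one_iff] at hi
  subst hi
  simpa using h

/-- The fold gives gate `i` access to the values of earlier gates only. Since arguments refer back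
and later values are appended at the end, the complete list of values satisfies the same local
equation. -/
theorem getD_gateFold {step : (ℕ → α) → Gate ι → α} {d : α}
    (hstep : ∀ g v v', (∀ j ∈ g.args, v j = v' j) → step v g = step v' g)
    (gs : List (Gate ι)) (hgs : RefersBack 0 gs) (i : ℕ) (g : Gate ι) (hg : gs[i]? = some g) :
    (gateFold step d gs).getD i d = step (fun j => (gateFold step d gs).getD j d) g := by
  induction gs using List.reverseRecOn generalizing i g with
  | nil => simp at hg
  | append_singleton gs g' ih =>
    have hlt : ∀ j, j < gs.length → (gateFold step d (gs ++ [g'])).getD j d =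
        (gateFold step d gs).getD j d := by
      intro j hj
      rw [gateFold_concat, List.getD_append _ _ _ _ (by rwa [length_gateFold])]
    have hi := (List.getElem?_eq_some_iff.mp hg).1
    have hargs := hgs i g hg
    rw [List.length_append, List.length_singleton] at hi
    have hcongr : step (fun j => (gateFold step d (gs ++ [g'])).getD j d) g =
        step (fun j => (gateFold step d gs).getD j d) g :=
      hstep _ _ _ fun j hj => hlt j (by have := hargs j hj; omega)
    rw [hcongr]
    by_cases hi' : i < gs.length
    · rw [hlt i hi']
      exact ih hgs.of_append i g (by rwa [List.getElem?_append_left hi'] at hg)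
    · have : i = gs.length := by omega
      subst this
      rw [gateFold_concat, List.getD_append_right _ _ _ _ (by rw [length_gateFold])]
      simp at hg
      simp [length_gateFold, hg]

theorem _root_.List.all_congr_mem {β : Type} {l : List β} {f g : β → Bool}
    (h : ∀ x ∈ l, f x = g x) : l.all f = l.all g := by
  rw [Bool.eq_iff_iff, List.all_eq_true, List.all_eq_true]
  exact forall₂_congr fun x hx => by rw [h x hx]

theorem _root_.List.any_congr_mem {β : Type} {l : List β} {f g : β → Bool}
    (h : ∀ x ∈ l, f x = g x) : l.any f = l.any g := by
  rw [Bool.eq_iff_iff, List.any_eq_true, List.any_eq_true]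
  exact exists_congr fun x => and_congr_right fun hx => by rw [h x hx]

theorem Gate.eval_congr {a : ι → Bool} (g : Gate ι) {v v' : ℕ → Bool}
    (h : ∀ j ∈ g.args, v j = v' j) : g.eval a v = g.eval a v' := by
  cases g with
  | input i => rfl
  | neg j => simp [Gate.eval, h j (by simp [Gate.args])]
  | conj js => exact List.all_congr_mem fun j hj => h j hj
  | disj js => exact List.any_congr_mem fun j hj => h j hj

theorem Circuit.refersBack (C : Circuit ι) : RefersBack 0 C.gates := by
  intro i g hg
  obtain ⟨hi, rfl⟩ := List.getElem?_eq_some_iff.mp hg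
  simpa using C.acyclic i hi

theorem Circuit.gateValue_eq (C : Circuit ι) (a : ι → Bool) {i : ℕ} {g : Gate ι}
    (hg : C.gates[i]? = some g) : C.gateValue a i = g.eval a (C.gateValue a) :=
  getD_gateFold (fun g _ _ h => g.eval_congr h) C.gates C.refersBack i g hg

end GateFold

/-! ### The circuit of the reduction -/

section Construction

/-- The number of gates of the reduction before the gates of the given circuit. -/
def shift (n k : ℕ) : ℕ := 3 * (n * k) + 2

/-- The input gates; gate number `u * k + r` reads the pair `(u, r)`. -/
def inputGates (n k : ℕ) : List (Gate (Fin n × Fin k)) :=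
  (List.finRange (n * k)).map fun p => .input (finProdFinEquiv.symm p)

/-- The numbers of the pairs `(u', r)` with `u' < u` and of the pairs `(u, r')` with `r' < r`. -/
def smaller (k u r : ℕ) : List ℕ :=
  (List.range u).map (fun u' => u' * k + r) ++ (List.range r).map fun r' => u * k + r'

/-- The gates that tell whether a pair is in conflict with one before it; whether there is such a
pair in the relation; and whether there is none. -/
def conflictGates (n k : ℕ) : List (Gate (Fin n × Fin k)) :=
  (List.range (n * k)).map (fun p => .disj (smaller k (p / k) (p % k))) ++
  (List.range (n * k)).map (fun p => .conj [p, n * k + p]) ++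
  [.disj ((List.range (n * k)).map fun p => 2 * (n * k) + p)] ++ [.neg (3 * (n * k))]

/-- A gate of the given circuit as a gate of the new one: the variable `u` stands for the
disjunction of the pairs `(u, r)`. -/
def liftGate (n k : ℕ) : Gate (Fin n) → Gate (Fin n × Fin k)
  | .input i => .disj ((List.range k).map fun r => i.val * k + r)
  | .neg j => .neg (shift n k + j)
  | .conj js => .conj (js.map fun j => shift n k + j)
  | .disj js => .disj (js.map fun j => shift n k + j)

/-- The last gate: the identity or a negation. -/
def lastGate {ι : Type} (negate : Bool) (j : ℕ) : Gate ι :=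
  -- Without negation the output says that the constraint holds, as APEP needs. With negation it is
  -- a weight, equal to `0` exactly when the constraint holds.
  if negate then .neg j else .conj [j]

/-- All gates of the new circuit. -/
def sparseGates {n : ℕ} (k : ℕ) (C : DecisionCircuit (Fin n)) (negate : Bool) :
    List (Gate (Fin n × Fin k)) :=
  -- Numbering, with `N = n * k` and `p = u * k + r`: `p` is the input for `(u, r)`; `N + p` says
  -- that some smaller pair in its row or column is present; `2 * N + p` says that moreover `(u, r)`
  -- is present; `3 * N` says that there is a conflict and `3 * N + 1` that there is none. The given
  -- circuit starts at `shift n k = 3 * N + 2`, followed by the conjunction and the last gate.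
  inputGates n k ++ conflictGates n k ++ C.gates.map (liftGate n k) ++
    [.conj [3 * (n * k) + 1, shift n k + C.out]] ++
    [lastGate negate (shift n k + C.gates.length)]

variable {n k : ℕ}

theorem length_inputGates : (inputGates n k).length = n * k := by simp [inputGates]

theorem length_conflictGates : (conflictGates n k).length = 2 * (n * k) + 2 := by
  simp [conflictGates]; omega

theorem DecisionCircuit.out_lt {ι : Type} (C : DecisionCircuit ι) : C.out < C.gates.length :=
  C.outs_lt _ (by simp [C.outs_eq])

theorem index_lt {u r : ℕ} (hu : u < n) (hr : r < k) : u * k + r < n * k := by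
  calc u * k + r < (u + 1) * k := by rw [Nat.succ_mul]; omega
    _ ≤ n * k := Nat.mul_le_mul_right k hu

theorem refersBack_sparseGates (C : DecisionCircuit (Fin n)) (negate : Bool) :
    RefersBack 0 (sparseGates k C negate) := by
  have hout := C.out_lt
  refine RefersBack.append (RefersBack.append (RefersBack.append (RefersBack.append ?_ ?_) ?_) ?_)
    ?_
  · intro i g hg
    obtain ⟨hi, rfl⟩ := List.getElem?_eq_some_iff.mp hg
    simp [inputGates, Gate.args]
  · refine RefersBack.append (RefersBack.append (RefersBack.append ?_ ?_) ?_) ?_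
    · refine RefersBack.map_range fun p hp j hj => ?_
      have hk : 0 < k := by
        rcases Nat.eq_zero_or_pos k with h | h
        · simp [h] at hp
        · exact h
      have h1 : p / k < n := Nat.div_lt_of_lt_mul (by rwa [Nat.mul_comm] at hp)
      have h2 : p % k < k := Nat.mod_lt _ hk
      rw [length_inputGates]
      simp only [Gate.args, smaller, List.mem_append, List.mem_map, List.mem_range] at hj
      rcases hj with ⟨u, hu, rfl⟩ | ⟨r, hr, rfl⟩
      · have := index_lt (hu.trans h1) h2; omega
      · have := index_lt h1 (hr.trans h2); omega
    · refine RefersBack.map_range fun p hp j hj => ?_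
      simp [Gate.args, length_inputGates] at hj ⊢
      omega
    · refine RefersBack.singleton fun j hj => ?_
      simp [Gate.args, length_inputGates] at hj ⊢
      omega
    · refine RefersBack.singleton fun j hj => ?_
      simp [Gate.args, length_inputGates] at hj ⊢
      omega
  · intro i g hg j hj
    obtain ⟨hi, rfl⟩ := List.getElem?_eq_some_iff.mp hg
    simp only [List.length_map] at hi
    have hac := C.acyclic i hi
    simp only [List.length_append, length_inputGates, length_conflictGates]
    rw [List.getElem_map] at hj
    revert hj hac
    cases C.gates[i] with
    | input u =>
      intro hj _
      simp only [liftGate, Gate.args, List.mem_map, List.mem_range] at hj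
      obtain ⟨r, hr, rfl⟩ := hj
      have := index_lt u.isLt hr; omega
    | neg j' => intro hj hac; simp [liftGate, Gate.args, shift] at hac hj; omega
    | conj js =>
      intro hj hac
      simp only [liftGate, Gate.args, shift, List.mem_map] at hac hj
      obtain ⟨j', hj', rfl⟩ := hj
      have := hac j' hj'; omega
    | disj js =>
      intro hj hac
      simp only [liftGate, Gate.args, shift, List.mem_map] at hac hj
      obtain ⟨j', hj', rfl⟩ := hj
      have := hac j' hj'; omega
  · refine RefersBack.singleton fun j hj => ?_
    simp [Gate.args, length_inputGates, length_conflictGates, shift] at hj ⊢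
    omega
  · refine RefersBack.singleton fun j hj => ?_
    have : j = shift n k + C.gates.length := by
      unfold lastGate at hj
      split at hj <;> simpa [Gate.args] using hj
    simp [length_inputGates, length_conflictGates, shift] at this ⊢
    omega

theorem length_sparseGates (C : DecisionCircuit (Fin n)) (negate : Bool) :
    (sparseGates k C negate).length = shift n k + C.gates.length + 2 := by
  simp [sparseGates, length_inputGates, length_conflictGates, shift]; omega

/-- The circuit that checks that the relation is the graph of an injective map from the resources
to the users whose image is accepted by the given circuit. -/
def sparseCircuit (k : ℕ) (C : DecisionCircuit (Fin n)) (negate : Bool) :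
    DecisionCircuit (Fin n × Fin k) where
  gates := sparseGates k C negate
  acyclic i hi j hj := by
    simpa using refersBack_sparseGates C negate i _ (List.getElem?_eq_getElem hi) j hj
  outs := [shift n k + C.gates.length + 1]
  outs_lt j hj := by
    rw [List.mem_singleton] at hj
    rw [length_sparseGates, hj]; omega
  out := shift n k + C.gates.length + 1
  outs_eq := rfl

/-- No two pairs share a user or a resource. -/
def Sparse (A : Finset (Fin n × Fin k)) : Prop :=
  ∀ p ∈ A, ∀ q ∈ A, p.1 = q.1 ∨ p.2 = q.2 → p = q

/-- The relation is sparse, and the circuit accepts the set of its users. -/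
def SparseAccepts (C : DecisionCircuit (Fin n)) (A : Finset (Fin n × Fin k)) : Prop :=
  Sparse A ∧ C.Accepts fun u => decide (∃ r, (u, r) ∈ A)

/-! ### Values of the gates of the new circuit -/

section Values

variable (C : DecisionCircuit (Fin n)) (negate : Bool) (A : Finset (Fin n × Fin k))

/-- The value of a gate of the new circuit. -/
def sparseValue (j : ℕ) : Bool :=
  (sparseCircuit k C negate).gateValue (fun p => decide (p ∈ A)) j

theorem sparseValue_eq {j : ℕ} {g : Gate (Fin n × Fin k)}
    (hg : (sparseGates k C negate)[j]? = some g) :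
    sparseValue C negate A j = g.eval (fun p => decide (p ∈ A)) (sparseValue C negate A) :=
  (sparseCircuit k C negate).gateValue_eq _ hg

theorem sparseValue_input (u : Fin n) (r : Fin k) :
    sparseValue C negate A (u.val * k + r.val) = decide ((u, r) ∈ A) := by
  have h := index_lt u.isLt r.isLt
  rw [sparseValue_eq C negate A (g := .input (u, r))]
  · rfl
  · simp only [sparseGates, List.append_assoc]
    rw [List.getElem?_append_left (by rwa [length_inputGates])]
    have : (⟨u.val * k + r.val, h⟩ : Fin (n * k)) = finProdFinEquiv (u, r) := by
      ext
      simp [finProdFinEquiv, Nat.mul_comm, Nat.add_comm]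
    simp only [inputGates, List.getElem?_map, List.getElem?_eq_getElem (l := List.finRange (n * k))
      (i := u.val * k + r.val) (by simpa using h), List.getElem_finRange, Fin.cast_mk, this,
      Equiv.symm_apply_apply, Option.map_some]

theorem getElem?_conflict {j : ℕ} (hj : j < 2 * (n * k) + 2) :
    (sparseGates k C negate)[n * k + j]? = (conflictGates n k)[j]? := by
  simp only [sparseGates, List.append_assoc]
  rw [List.getElem?_append_right (by simp [length_inputGates]), length_inputGates,
    Nat.add_sub_cancel_left, List.getElem?_append_left (by simpa [length_conflictGates] using hj)]

theorem getElem?_lift {j : ℕ} (hj : j < C.gates.length) :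
    (sparseGates k C negate)[shift n k + j]? = some (liftGate n k C.gates[j]) := by
  have h : (inputGates n k ++ conflictGates n k).length = shift n k := by
    simp [length_inputGates, length_conflictGates, shift]; omega
  unfold sparseGates
  rw [List.append_assoc, List.append_assoc, List.getElem?_append_right (by omega), h,
    Nat.add_sub_cancel_left, List.getElem?_append_left (by simpa using hj)]
  simp [hj]

theorem sparseValue_smaller (u : Fin n) (r : Fin k) :
    sparseValue C negate A (n * k + (u.val * k + r.val)) = true ↔
      (∃ u' < u, (u', r) ∈ A) ∨ ∃ r' < r, (u, r') ∈ A := by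
  have h := index_lt u.isLt r.isLt
  have hk : 0 < k := r.pos
  rw [sparseValue_eq C negate A (g := .disj (smaller k u r))]
  · simp only [Gate.eval, smaller, List.any_append, List.any_map, Bool.or_eq_true, List.any_eq_true,
      List.mem_range, Function.comp_apply]
    refine or_congr ⟨?_, ?_⟩ ⟨?_, ?_⟩
    · rintro ⟨u', hu', hv⟩
      have := sparseValue_input C negate A ⟨u', hu'.trans u.isLt⟩ r
      rw [hv] at this
      exact ⟨_, hu', by simpa using this⟩
    · rintro ⟨u', hu', hv⟩
      exact ⟨u', hu', by rw [sparseValue_input]; simpa using hv⟩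
    · rintro ⟨r', hr', hv⟩
      have := sparseValue_input C negate A u ⟨r', hr'.trans r.isLt⟩
      rw [hv] at this
      exact ⟨_, hr', by simpa using this⟩
    · rintro ⟨r', hr', hv⟩
      exact ⟨r', hr', by rw [sparseValue_input]; simpa using hv⟩
  · rw [getElem?_conflict _ _ (by omega)]
    simp only [conflictGates, List.append_assoc]
    rw [List.getElem?_append_left (by simpa using h)]
    have h1 : (u.val * k + r.val) / k = u := by
      rw [Nat.mul_comm, Nat.mul_add_div hk, Nat.div_eq_of_lt r.isLt, Nat.add_zero]
    have h2 : (u.val * k + r.val) % k = r := by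
      rw [Nat.mul_comm, Nat.mul_add_mod, Nat.mod_eq_of_lt r.isLt]
    simp [h, h1, h2]

theorem sparseValue_both {p : ℕ} (hp : p < n * k) :
    sparseValue C negate A (2 * (n * k) + p) =
      (sparseValue C negate A p && sparseValue C negate A (n * k + p)) := by
  rw [sparseValue_eq C negate A (g := .conj [p, n * k + p])]
  · simp [Gate.eval]
  · rw [show 2 * (n * k) + p = n * k + (n * k + p) by omega, getElem?_conflict _ _ (by omega)]
    simp only [conflictGates, List.append_assoc]
    rw [List.getElem?_append_right (by simp), List.getElem?_append_left (by simpa using hp)]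
    simp [hp]

theorem sparseValue_any :
    sparseValue C negate A (3 * (n * k)) = true ↔
      ∃ p < n * k, sparseValue C negate A (2 * (n * k) + p) = true := by
  rw [sparseValue_eq C negate A (g := .disj ((List.range (n * k)).map fun p => 2 * (n * k) + p))]
  · simp [Gate.eval]
  · rw [show 3 * (n * k) = n * k + 2 * (n * k) by omega, getElem?_conflict _ _ (by omega)]
    simp only [conflictGates]
    rw [List.getElem?_append_left (by simp; omega), List.getElem?_append_right (by simp; omega)]
    simp [two_mul]

theorem sparseValue_none :
    sparseValue C negate A (3 * (n * k) + 1) = !sparseValue C negate A (3 * (n * k)) := by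
  rw [sparseValue_eq C negate A (g := .neg (3 * (n * k)))]
  · rfl
  · rw [show 3 * (n * k) + 1 = n * k + (2 * (n * k) + 1) by omega,
      getElem?_conflict _ _ (by omega)]
    simp only [conflictGates]
    rw [List.getElem?_append_right (by simp; omega)]
    simp [two_mul]

/-- Two distinct pairs with a common user or resource differ in the other coordinate, and there one
of them is smaller. So it suffices to compare each pair with the smaller ones in its row and column.
-/
theorem sparseValue_none_iff :
    sparseValue C negate A (3 * (n * k) + 1) = true ↔ Sparse A := by
  rw [sparseValue_none, Bool.not_eq_true', ← Bool.not_eq_true, sparseValue_any]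
  constructor
  · intro h
    have key : ∀ (u : Fin n) (r : Fin k), (u, r) ∈ A →
        ¬((∃ u' < u, (u', r) ∈ A) ∨ ∃ r' < r, (u, r') ∈ A) := by
      intro u r hur hc
      refine h ⟨u * k + r, index_lt u.isLt r.isLt, ?_⟩
      rw [sparseValue_both _ _ _ (index_lt u.isLt r.isLt), sparseValue_input,
        (sparseValue_smaller C negate A u r).mpr hc]
      simpa using hur
    rintro ⟨u, r⟩ hp ⟨u', r'⟩ hq (h' | h')
    · obtain rfl : u = u' := h'
      rcases lt_trichotomy r r' with h'' | rfl | h''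
      · exact (key _ _ hq (Or.inr ⟨r, h'', hp⟩)).elim
      · rfl
      · exact (key _ _ hp (Or.inr ⟨r', h'', hq⟩)).elim
    · obtain rfl : r = r' := h'
      rcases lt_trichotomy u u' with h'' | rfl | h''
      · exact (key _ _ hq (Or.inl ⟨u, h'', hp⟩)).elim
      · rfl
      · exact (key _ _ hp (Or.inl ⟨u', h'', hq⟩)).elim
  · rintro h ⟨p, hp, hv⟩
    rw [sparseValue_both _ _ _ hp, Bool.and_eq_true] at hv
    obtain ⟨⟨u, r⟩, hur⟩ := finProdFinEquiv.surjective (⟨p, hp⟩ : Fin (n * k))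
    have hpe : p = u * k + r := by
      have := congrArg Fin.val hur
      simpa [finProdFinEquiv, Nat.mul_comm, Nat.add_comm] using this.symm
    rw [hpe, sparseValue_input, sparseValue_smaller] at hv
    have hmem : (u, r) ∈ A := by simpa using hv.1
    rcases hv.2 with ⟨u', hu', hq⟩ | ⟨r', hr', hq⟩
    · have := h _ hmem _ hq (Or.inr rfl)
      simp only [Prod.mk.injEq, and_true] at this
      exact hu'.ne this.symm
    · have := h _ hmem _ hq (Or.inl rfl)
      simp only [Prod.mk.injEq, true_and] at this
      exact hr'.ne this.symm

/-- Strong induction along the topological order: a variable gate now tells whether its user occurs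
in the relation, and all other gates only have their arguments shifted. -/
theorem sparseValue_lift {j : ℕ} (hj : j < C.gates.length) :
    sparseValue C negate A (shift n k + j) =
      C.gateValue (fun u => decide (∃ r, (u, r) ∈ A)) j := by
  induction j using Nat.strong_induction_on with
  | _ j ih =>
  rw [sparseValue_eq C negate A (getElem?_lift C negate hj),
    C.gateValue_eq _ (List.getElem?_eq_getElem hj)]
  have hac := C.acyclic j hj
  revert hac
  cases C.gates[j] with
  | input u =>
    intro _
    rw [Bool.eq_iff_iff]
    simp only [liftGate, Gate.eval, List.any_map, List.any_eq_true, List.mem_range,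
      Function.comp_apply, decide_eq_true_eq]
    constructor
    · rintro ⟨r, hr, hv⟩
      have := sparseValue_input C negate A u ⟨r, hr⟩
      rw [hv] at this
      exact ⟨_, by simpa using this⟩
    · rintro ⟨r, hr⟩
      exact ⟨r, r.isLt, by rw [sparseValue_input]; simpa using hr⟩
  | neg i =>
    intro hac
    have hi := hac i (by simp [Gate.args])
    simp only [liftGate, Gate.eval]
    rw [ih i hi (hi.trans hj)]
  | conj js =>
    intro hac
    simp only [liftGate, Gate.eval, List.all_map]
    exact List.all_congr_mem fun i hi => ih i (hac i hi) ((hac i hi).trans hj)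
  | disj js =>
    intro hac
    simp only [liftGate, Gate.eval, List.any_map]
    exact List.any_congr_mem fun i hi => ih i (hac i hi) ((hac i hi).trans hj)

theorem sparseValue_conj :
    sparseValue C negate A (shift n k + C.gates.length) = true ↔ SparseAccepts C A := by
  rw [sparseValue_eq C negate A (g := .conj [3 * (n * k) + 1, shift n k + C.out])]
  · simp only [Gate.eval, List.all_cons, List.all_nil, Bool.and_true, Bool.and_eq_true]
    rw [sparseValue_none_iff, sparseValue_lift C negate A C.out_lt]
    rfl
  · have h : (inputGates n k ++ conflictGates n k ++ C.gates.map (liftGate n k)).length =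
        shift n k + C.gates.length := by
      simp [length_inputGates, length_conflictGates, shift]; omega
    unfold sparseGates
    rw [List.append_assoc, List.getElem?_append_right (by omega), h]
    simp

/-- One statement for both polarities: the constraint of APEP and the weight in Valued APEP are read
off from it. -/
theorem sparseValue_last :
    sparseValue C negate A (shift n k + C.gates.length + 1) = true ↔
      (SparseAccepts C A ↔ negate = false) := by
  have h : (inputGates n k ++ conflictGates n k ++ C.gates.map (liftGate n k) ++
      [Gate.conj [3 * (n * k) + 1, shift n k + C.out]]).length = shift n k + C.gates.length + 1 := by
    simp [length_inputGates, length_conflictGates, shift]; omega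
  rw [sparseValue_eq C negate A (g := lastGate negate (shift n k + C.gates.length))]
  · cases negate
    · simp [lastGate, Gate.eval, sparseValue_conj]
    · simp only [lastGate, Gate.eval, if_true, Bool.true_eq_false, iff_false]
      rw [← sparseValue_conj C true A]
      simp
  · unfold sparseGates
    rw [List.getElem?_append_right (by omega), h]
    simp

end Values

theorem satisfies_sparseCircuit (C : DecisionCircuit (Fin n)) (A : Finset (Fin n × Fin k)) :
    APEPInstance.Satisfies A (sparseCircuit k C false) ↔ SparseAccepts C A := by
  have := sparseValue_last C false A
  rwa [iff_true_intro (rfl : false = false), iff_true] at this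

/-- There is a single output gate, so the weight is one binary digit. -/
theorem constraintWeight_sparseCircuit (C : DecisionCircuit (Fin n))
    (A : Finset (Fin n × Fin k)) :
    constraintWeight (sparseCircuit k C true).toCircuit A ≤ 1 ∧
      (constraintWeight (sparseCircuit k C true).toCircuit A = 0 ↔ SparseAccepts C A) := by
  have h := sparseValue_last C true A
  have hw : constraintWeight (sparseCircuit k C true).toCircuit A =
      (sparseValue C true A (shift n k + C.gates.length + 1)).toNat := by
    simp [constraintWeight, Circuit.number, sparseCircuit, sparseValue]
  rw [hw]
  cases hv : sparseValue C true A (shift n k + C.gates.length + 1)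
  · rw [hv] at h
    simpa using h
  · rw [hv] at h
    simpa using h

end Construction

/-! ### Boundedness and correctness -/

section Bounded

variable {n k : ℕ}

/-- The projection to the resources is injective on a sparse relation. -/
theorem Sparse.card_le {A : Finset (Fin n × Fin k)} (h : Sparse A) : A.card ≤ k := by
  have : (A.image Prod.snd).card = A.card :=
    Finset.card_image_of_injOn fun p hp q hq hpq => h p hp q hq (Or.inr hpq)
  rw [← this]
  exact (Finset.card_le_univ _).trans (by simp)

theorem removeUser_of_notMem {A : Finset (Fin n × Fin k)} {u : Fin n}
    (hu : u ∉ A.image Prod.fst) : removeUser A u = A := by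
  unfold removeUser
  refine Finset.filter_true_of_mem fun p hp hpu => hu ?_
  exact Finset.mem_image.mpr ⟨p, hp, hpu⟩

theorem Complete.exists_users {A : Finset (Fin n × Fin k)} (hA : Complete A) :
    ∃ U' : Finset (Fin n), U'.card ≤ k ∧ ∀ u, u ∉ U' → Complete (removeUser A u) := by
  choose φ hφ using hA
  refine ⟨Finset.univ.image φ, Finset.card_image_le.trans (by simp), fun u hu r => ⟨φ r, ?_⟩⟩
  refine Finset.mem_filter.mpr ⟨hφ r, fun h => hu ?_⟩
  exact Finset.mem_image.mpr ⟨r, Finset.mem_univ _, h⟩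

/-- A constraint that admits sparse relations only is bounded. -/
theorem bounded_of_sparse {c : Finset (Fin n × Fin k) → Prop} (hc : ∀ A, c A → Sparse A) :
    Bounded k c := by
  intro A hA hcA
  refine ⟨A.image Prod.fst, Finset.card_image_le.trans (hc A hcA).card_le, fun u hu => ?_⟩
  rw [removeUser_of_notMem hu]
  exact ⟨hA, hcA⟩

/-- At weight `0` the relation is sparse, its at most `k` users serve as `U'`, and removing another
user changes nothing. Otherwise the weight is already maximal, and only completeness has to survive:
one chosen user per resource suffices. -/
theorem boundedWeight_of_sparse {w : Finset (Fin n × Fin k) → ℕ} (h1 : ∀ A, w A ≤ 1)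
    (h0 : ∀ A, w A = 0 → Sparse A) : BoundedWeight k w := by
  intro A hA
  by_cases hw : w A = 0
  · refine ⟨A.image Prod.fst, Finset.card_image_le.trans (h0 A hw).card_le, fun u hu => ?_⟩
    rw [removeUser_of_notMem hu]
    exact ⟨hA, le_rfl⟩
  · obtain ⟨U', hU', h⟩ := hA.exists_users
    exact ⟨U', hU', fun u hu => ⟨h u hu, (h1 _).trans (Nat.one_le_iff_ne_zero.mpr hw)⟩⟩

/-- More than `k` pairs exclude sparsity, so the weight is already maximal. The graph of a choice of
one user per resource is complete, is contained in the relation and has at most `k` pairs. -/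
theorem wBounded_of_sparse {w : Finset (Fin n × Fin k) → ℕ} (h1 : ∀ A, w A ≤ 1)
    (h0 : ∀ A, w A = 0 → Sparse A) : WBounded k [w] := by
  intro A hA hcard
  have hw : w A ≠ 0 := fun h => by have := (h0 A h).card_le; omega
  choose φ hφ using hA
  refine ⟨Finset.univ.image fun r => (φ r, r), fun r => ⟨φ r, by simp⟩, ?_, ?_, ?_⟩
  · intro p hp
    obtain ⟨r, _, rfl⟩ := Finset.mem_image.mp hp
    exact hφ r
  · exact (Finset.card_image_le.trans (by simp)).trans_lt hcard
  · have := h1 (Finset.univ.image fun r => (φ r, r))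
    simp only [totalWeight, List.map_cons, List.map_nil, List.sum_cons, List.sum_nil]
    omega

/-- Complete relations that satisfy the constraint correspond to accepted assignments of
weight `k`. -/
theorem exists_sparseAccepts_iff (C : DecisionCircuit (Fin n)) :
    (∃ A : Finset (Fin n × Fin k), Complete A ∧ SparseAccepts C A) ↔
      ∃ a : Fin n → Bool, (Finset.univ.filter fun i => a i = true).card = k ∧ C.Accepts a := by
  constructor
  · rintro ⟨A, hA, hs, hacc⟩
    -- The assignment is the indicator of the users that occur. By sparsity the choice `φ` of a user
    -- per resource is injective and reaches all of them, so there are `k`.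
    refine ⟨_, ?_, hacc⟩
    choose φ hφ using hA
    have hinj : Function.Injective φ := fun r r' h => by
      have := hs _ (hφ r) _ (hφ r') (Or.inl h)
      exact (Prod.mk.inj this).2
    have himg : (Finset.univ.filter fun u => decide (∃ r, (u, r) ∈ A) = true) =
        Finset.univ.image φ := by
      ext u
      simp only [Finset.mem_filter, Finset.mem_univ, true_and, decide_eq_true_eq,
        Finset.mem_image]
      constructor
      · rintro ⟨r, hr⟩
        exact ⟨r, (Prod.mk.inj (hs _ (hφ r) _ hr (Or.inr rfl))).1⟩
      · rintro ⟨r, rfl⟩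
        exact ⟨r, hφ r⟩
    rw [himg, Finset.card_image_of_injective _ hinj]
    simp
  · rintro ⟨a, hcard, hacc⟩
    -- An enumeration of the true variables by the resources; the relation is the graph of its
    -- inverse.
    have e := (Finset.univ.filter fun i => a i = true).equivFinOfCardEq hcard
    refine ⟨Finset.univ.image fun r => ((e.symm r).val, r), fun r => ⟨(e.symm r).val, by simp⟩,
      ?_, ?_⟩
    · intro p hp q hq h
      simp only [Finset.mem_image, Finset.mem_univ, true_and] at hp hq
      obtain ⟨r, rfl⟩ := hp
      obtain ⟨r', rfl⟩ := hq
      have : r = r' := by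
        rcases h with h | h
        · exact e.symm.injective (Subtype.ext h)
        · exact h
      rw [this]
    · convert hacc using 2 with u
      rw [Bool.eq_iff_iff]
      simp only [Finset.mem_image, Finset.mem_univ, true_and, Prod.mk.injEq, decide_eq_true_eq]
      constructor
      · rintro ⟨_, r, hr, _⟩
        have := (e.symm r).2
        rw [hr] at this
        exact (Finset.mem_filter.mp this).2
      · intro hu
        exact ⟨e ⟨u, by simpa using hu⟩, _, by simp, rfl⟩

end Bounded

/-! ### The instances of the reduction -/

/-- The instance of APEP for an instance of weighted circuit satisfiability. -/
def apepOf (I : WCSInstance) : APEPInstance where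
  n := I.numVars
  k := I.weight
  base := Finset.univ
  constraints := [sparseCircuit I.weight I.circuit false]

/-- The circuit for the constant weight `0`. -/
def zeroCircuit (k : ℕ) : Circuit (Fin k) where
  gates := []
  acyclic := by simp
  -- The empty list of digits represents `0`.
  outs := []
  outs_lt := by simp

/-- The instance of Valued APEP for an instance of weighted circuit satisfiability. -/
def valuedAPEPOf (I : WCSInstance) : ValuedAPEPInstance where
  n := I.numVars
  k := I.weight
  constraints := [(sparseCircuit I.weight I.circuit true).toCircuit]
  userCircuit _ := zeroCircuit I.weight
  isUserWeight := ⟨fun _ _ _ => rfl, fun _ _ _ _ => le_rfl⟩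
  budget := 0

theorem exists_valid_apepOf (I : WCSInstance) :
    (∃ A, (apepOf I).Valid A) ↔ ∃ a : Fin I.numVars → Bool,
      (Finset.univ.filter fun i => a i = true).card = I.weight ∧ I.circuit.Accepts a := by
  rw [← exists_sparseAccepts_iff]
  refine exists_congr fun A => Iff.trans ?_
    (and_congr_right fun _ => satisfies_sparseCircuit (n := I.numVars) (k := I.weight) I.circuit A)
  constructor
  · rintro ⟨_, hA, h⟩
    exact ⟨hA, h _ (List.mem_singleton.mpr rfl)⟩
  · rintro ⟨hA, h⟩
    refine ⟨Finset.subset_univ A, hA, fun c hc => ?_⟩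
    obtain rfl := List.mem_singleton.mp hc
    exact h

theorem bounded_apepOf (I : WCSInstance) :
    (apepOf I).IsWBounded (apepOf I).k ∧ (apepOf I).AllBounded (apepOf I).k := by
  constructor
  · refine wBounded_of_sparse (n := I.numVars) (k := I.weight)
      (w := APEPInstance.violation (sparseCircuit I.weight I.circuit false)) (fun A => ?_)
      fun A h => ?_
    · unfold APEPInstance.violation; split <;> omega
    · unfold APEPInstance.violation at h
      by_contra hs
      rw [if_neg fun h' => hs ((satisfies_sparseCircuit I.circuit A).mp h').1] at h
      cases h
  · intro c hc
    obtain rfl := List.mem_singleton.mp hc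
    exact bounded_of_sparse (n := I.numVars) (k := I.weight)
      fun A h => ((satisfies_sparseCircuit I.circuit A).mp h).1

theorem exists_weight_valuedAPEPOf_le (I : WCSInstance) :
    (∃ A : Finset (Fin (valuedAPEPOf I).n × Fin (valuedAPEPOf I).k), Complete A ∧
      (valuedAPEPOf I).weight A ≤ (valuedAPEPOf I).budget) ↔ ∃ a : Fin I.numVars → Bool,
      (Finset.univ.filter fun i => a i = true).card = I.weight ∧ I.circuit.Accepts a := by
  rw [← exists_sparseAccepts_iff]
  refine exists_congr fun A => and_congr_right fun _ => Iff.trans ?_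
    (constraintWeight_sparseCircuit (n := I.numVars) (k := I.weight) I.circuit A).2
  have : (valuedAPEPOf I).weight A =
      constraintWeight (sparseCircuit I.weight I.circuit true).toCircuit A := by
    have hu : ∀ u, (valuedAPEPOf I).userWeight u (resourcesOf A u) = 0 := fun _ => rfl
    simp only [ValuedAPEPInstance.weight, hu, Finset.sum_const_zero, Nat.zero_add, totalWeight]
    simp [valuedAPEPOf]
  rw [this]
  exact Nat.le_zero

theorem bounded_valuedAPEPOf (I : WCSInstance) :
    (valuedAPEPOf I).IsWBounded (valuedAPEPOf I).k ∧
      (valuedAPEPOf I).AllBounded (valuedAPEPOf I).k := by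
  have h1 := fun A => (constraintWeight_sparseCircuit (k := I.weight) I.circuit A).1
  have h0 := fun A h =>
    ((constraintWeight_sparseCircuit (k := I.weight) I.circuit A).2.mp h).1
  constructor
  · exact wBounded_of_sparse h1 h0
  · intro c hc
    obtain rfl := List.mem_singleton.mp hc
    exact boundedWeight_of_sparse h1 h0

end ParamAPEP

/-! ### A stack program that writes the new instances -/

namespace ParamAPEP

open Function

/-! ### Programs that emit words -/

/-- The stacks of the program of the reduction. -/
inductive Stk : Type
  -- `inp` holds the unread input and `out` the reversed output. The numbers `n` and `k` are stored
  -- twice, since a loop consumes its counter while inner programs still need the value. `idxU` and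
  -- `idxR` hold the current pair, `gates` counts the copied gates, and `idx₁`, `idx₂`, `tmp` serve
  -- inner loops.
  | io | inp | out | users | users' | ress | ress' | gates | idxU | idxR | idx₁ | idx₂ | tmp
  deriving DecidableEq

instance : Fintype Stk where
  elems := {.io, .inp, .out, .users, .users', .ress, .ress', .gates, .idxU, .idxR, .idx₁, .idx₂,
    .tmp}
  complete s := by cases s <;> simp

/-- The contents of all stacks. -/
abbrev Store := Stk → List Bool

/-- The word of `m` ones. -/
def ones (m : ℕ) : List Bool := List.replicate m true

theorem ones_zero : ones 0 = [] := rfl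

theorem ones_succ (m : ℕ) : ones (m + 1) = true :: ones m := rfl

theorem ones_one : ones 1 = [true] := rfl

theorem ones_add (m m' : ℕ) : ones (m + m') = ones m ++ ones m' :=
  List.replicate_add ..

theorem length_ones (m : ℕ) : (ones m).length = m := List.length_replicate

theorem reverse_ones (m : ℕ) : (ones m).reverse = ones m := List.reverse_replicate

theorem natWord_eq (m : ℕ) : natWord m = ones m ++ [false] := rfl

theorem flatMap_range_ones (m u : ℕ) : (List.range u).flatMap (fun _ => ones m) = ones (u * m) := by
  induction u with
  | zero => simp [ones]
  | succ u ih => rw [List.range_succ, List.flatMap_append, ih, Nat.succ_mul, ones_add]; simp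

theorem flatMap_range_true (u : ℕ) : (List.range u).flatMap (fun _ => [true]) = ones u := by
  simpa [ones_one] using flatMap_range_ones 1 u

open Cmd in
/-- The program `c` turns the store `S` into `S'` and appends the word `w` to the output, which is
kept in reverse order, in at most `t` steps. -/
def Emits (c : Cmd Stk) (S S' : Store) (w : List Bool) (t : ℕ) : Prop :=
  -- The output `o` written so far is arbitrary, so that programs can be chained; the contents of
  -- `out` in `S` and `S'` play no role.
  ∀ o, ∃ t' ≤ t, Runs c (update S .out o) t' (update S' .out (w.reverse ++ o))

theorem runs_pour (x y : Stk) (hxy : x ≠ y) (l : List Bool) (S : Store) (hx : S x = l) :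
    Cmd.Runs (.pour x y) S (l.length + 1) (update (update S x []) y (l.reverse ++ S y)) := by
  induction l generalizing S with
  | nil =>
    have := Cmd.Runs.pour_nil x y S hx
    rwa [← update_eq_self y (update S x []), update_of_ne hxy.symm] at this
  | cons b l ih =>
    have h1 := ih (update (update S x l) y (b :: update S x l y))
      (by rw [update_of_ne hxy, update_self])
    have h2 := Cmd.Runs.pour_cons x y S _ _ b l hx h1
    rw [update_of_ne hxy.symm, update_self, update_comm hxy.symm, update_idem, update_idem] at h2
    simpa [Nat.add_comm] using h2

namespace Emits

open Cmd

variable {c d : Cmd Stk} {S S' S'' : Store} {w w' : List Bool} {t t' : ℕ}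

theorem mono (h : Emits c S S' w t) (ht : t ≤ t') : Emits c S S' w t' := fun o =>
  let ⟨s, hs, hr⟩ := h o
  ⟨s, hs.trans ht, hr⟩

theorem congr (h : Emits c S S' w t) (hw : w' = w) : Emits c S S' w' t := hw ▸ h

theorem skip : Emits .skip S S [] 1 := fun _ => ⟨1, le_rfl, Runs.skip _⟩

theorem emit (b : Bool) : Emits (.push .out b) S S [b] 1 := fun o => by
  refine ⟨1, le_rfl, ?_⟩
  have := Runs.push .out b (update S .out o)
  rwa [update_idem, update_self] at this

theorem push {x : Stk} (hk : x ≠ .out) (b : Bool) :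
    Emits (.push x b) S (update S x (b :: S x)) [] 1 := fun o => by
  refine ⟨1, le_rfl, ?_⟩
  have := Runs.push x b (update S .out o)
  rwa [update_of_ne hk, update_comm hk.symm] at this

theorem seq (h : Emits c S S' w t) (h' : Emits d S' S'' w' t') :
    Emits (.seq c d) S S'' (w ++ w') (t + t') := fun o => by
  obtain ⟨s, hs, hr⟩ := h o
  obtain ⟨s', hs', hr'⟩ := h' (w.reverse ++ o)
  refine ⟨s + s', by omega, ?_⟩
  rw [List.reverse_append, List.append_assoc]
  exact hr.seq hr'

theorem ifpop_true {x : Stk} (hk : x ≠ .out) {l : List Bool} (hS : S x = true :: l)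
    (h : Emits c (update S x l) S' w t) : Emits (.ifpop x c d) S S' w (t + 1) := fun o => by
  obtain ⟨s, hs, hr⟩ := h o
  refine ⟨1 + s, by omega, Runs.ifpop_true ?_ ?_⟩
  · rw [update_of_ne hk, hS]; rfl
  · rwa [update_of_ne hk, hS, List.tail_cons, update_comm hk.symm]

theorem ifpop_false {x : Stk} (hk : x ≠ .out) {l : List Bool} (hS : S x = false :: l)
    (h : Emits d (update S x l) S' w t) : Emits (.ifpop x c d) S S' w (t + 1) := fun o => by
  obtain ⟨s, hs, hr⟩ := h o
  refine ⟨1 + s, by omega, Runs.ifpop_false ?_ ?_⟩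
  · rw [update_of_ne hk, hS]; simp
  · rwa [update_of_ne hk, hS, List.tail_cons, update_comm hk.symm]

/-- `F i` describes the other stacks after `i` iterations. The test consumes the announcing bit of
each entry, and finally the head of `rest` as well. With `rest = false :: l` the loop reads a
self-delimiting list or number; with `rest = []` it uses up a unary counter. -/
theorem loop {x : Stk} (hk : x ≠ .out) {α : Type} (e w : α → List Bool) (t : ℕ)
    {rest : List Bool} (hrest : rest.head? ≠ some true) (l : List α) (F : ℕ → Store)
    (h : ∀ i z r, l[i]? = some z →
      Emits c (update (F i) x (e z ++ r)) (update (F (i + 1)) x r) (w z) t) :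
    Emits (.loop x c) (update (F 0) x (l.flatMap (fun z => true :: e z) ++ rest))
      (update (F l.length) x rest.tail) (l.flatMap w) (l.length * (t + 1) + 1) := by
  induction l generalizing F with
  | nil =>
    intro o
    refine ⟨1, by simp, ?_⟩
    have := Runs.loop_false (k := x) (c := c) (S := update (update (F 0) x rest) .out o)
      (by rwa [update_of_ne hk, update_self])
    rwa [update_of_ne hk, update_self, update_comm hk.symm, update_idem] at this
  | cons z l ih =>
    intro o
    obtain ⟨s, hs, hr⟩ := h 0 z (l.flatMap (fun z => true :: e z) ++ rest) rfl o
    obtain ⟨s', hs', hr'⟩ := ih (fun i => F (i + 1))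
      (fun i z r hx => h (i + 1) z r (by simpa using hx)) ((w z).reverse ++ o)
    refine ⟨1 + (s + s'), ?_, Runs.loop_true ?_ ?_ ?_ (S' := update (update (F 1) x
      (l.flatMap (fun z => true :: e z) ++ rest)) .out ((w z).reverse ++ o))⟩
    · rw [List.length_cons, Nat.succ_mul]; omega
    · rw [update_of_ne hk, update_self]; rfl
    · rw [update_of_ne hk, update_self, update_comm hk.symm, update_idem]
      simpa using hr
    · simpa using hr'

theorem pour {x y : Stk} (hk : x ≠ .out) (hy : y ≠ .out) (hkk : x ≠ y) :
    Emits (.pour x y) S (update (update S x []) y ((S x).reverse ++ S y)) []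
      ((S x).length + 1) := by
  intro o
  refine ⟨_, le_rfl, ?_⟩
  have := runs_pour x y hkk (S x) (update S .out o) (by rw [update_of_ne hk])
  rwa [update_of_ne hy, update_comm hk.symm, update_comm hy.symm] at this

end Emits

/-- Emits a given word. -/
def emitWord : List Bool → Cmd Stk
  | [] => .skip
  | b :: l => .seq (.push .out b) (emitWord l)

theorem emits_emitWord (S : Store) (l : List Bool) : Emits (emitWord l) S S l (l.length + 1) := by
  induction l with
  | nil => exact Emits.skip
  | cons b l ih => exact ((Emits.emit b).seq ih).mono (by simp; omega)

/-- Runs `c` for `idx = 0, 1, …, cnt - 1`, where all these numbers are in unary. -/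
def forEach (cnt idx : Stk) (c : Cmd Stk) : Cmd Stk :=
  .seq (.loop cnt (.seq c (.push idx true))) (.pour idx cnt)

/-- The time for at most `L` iterations. -/
def forTime (L t : ℕ) : ℕ := L * (t + 2) + L + 2

/-- The loop moves the counter from `cnt` to `idx` one by one, so `idx` shows the current index, and
the final `pour` restores both stacks. The body must work for any remaining content `r` of `cnt`. -/
theorem emits_forEach {cnt idx : Stk} (hc : cnt ≠ .out) (hi : idx ≠ .out) (hci : cnt ≠ idx)
    {c : Cmd Stk} {S : Store} {m L t : ℕ} (hcnt : S cnt = ones m) (hidx : S idx = [])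
    (hL : m ≤ L) (w : ℕ → List Bool)
    (h : ∀ i < m, ∀ r, Emits c (update (update S idx (ones i)) cnt r)
      (update (update S idx (ones i)) cnt r) (w i) t) :
    Emits (forEach cnt idx c) S S ((List.range m).flatMap w) (forTime L t) := by
  have hloop := Emits.loop (x := cnt) (c := .seq c (.push idx true)) hc (fun _ => []) w (t + 1)
    (rest := []) (by simp) (List.range m) (fun i => update S idx (ones i)) (fun i x r hx => by
      obtain ⟨hx', rfl⟩ := List.getElem?_eq_some_iff.mp hx
      simp only [List.length_range] at hx'
      simp only [List.getElem_range, List.nil_append]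
      have h2 := (h i hx' r).seq (Emits.push hi true)
      have e : update (update (update S idx (ones i)) cnt r) idx
          (true :: update (update S idx (ones i)) cnt r idx) =
          update (update S idx (ones (i + 1))) cnt r := by
        rw [update_of_ne hci.symm, update_self, update_comm hci, update_idem, ones_succ]
      rwa [List.append_nil, e] at h2)
  have hpour := Emits.pour (S := update (update S idx (ones m)) cnt []) hi hc hci.symm
  have hS : update (update S idx (ones 0)) cnt
      ((List.range m).flatMap (fun _ => [true]) ++ []) = S := by
    rw [List.append_nil, flatMap_range_true, ← hcnt, ones_zero, ← hidx, update_eq_self,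
      update_eq_self]
  have hS' : update (update (update (update S idx (ones m)) cnt []) idx []) cnt
      ((update (update S idx (ones m)) cnt [] idx).reverse ++
        update (update S idx (ones m)) cnt [] cnt) = S := by
    rw [update_of_ne hci.symm, update_self, update_self, List.append_nil, reverse_ones,
      update_comm hci, update_idem, update_idem, ← hcnt, ← hidx, update_eq_self, update_eq_self]
  rw [hS'] at hpour
  rw [hS, List.length_range, List.tail_nil] at hloop
  refine (List.append_nil ((List.range m).flatMap w) ▸ hloop.seq hpour).mono ?_
  rw [update_of_ne hci.symm, update_self, length_ones, forTime]
  have := Nat.mul_le_mul_right (t + 1 + 1) hL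
  simp only [Nat.mul_add] at *
  omega

end ParamAPEP

namespace ParamAPEP

open Function

/-! ### Programs that emit numbers -/

infixr:60 " ;; " => Cmd.seq

/-- Emits the contents of a stack of ones. -/
def unary (x : Stk) : Cmd Stk := forEach x .tmp (.push .out true)

/-- Emits `u * k` ones, when `x` holds `u` ones. -/
def rowStart (x : Stk) : Cmd Stk := forEach x .idx₂ (unary .ress')

/-- Emits the number of the input gate for a pair. -/
def pairIndex (x y : Stk) : Cmd Stk := rowStart x ;; unary y ;; emitWord [false]

/-- Emits three times `n * k` ones. -/
def tripleTotal : Cmd Stk := rowStart .users' ;; rowStart .users' ;; rowStart .users'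

/-- Emits `shift n k` ones. -/
def emitShift : Cmd Stk := tripleTotal ;; emitWord [true, true]

/-- Runs a program for all pairs of a user and a resource. -/
def forPairs (c : Cmd Stk) : Cmd Stk := forEach .users .idxU (forEach .ress .idxR c)

/-- Time for `unary`. -/
def unaryTime (L : ℕ) : ℕ := forTime L 1

/-- Time for `rowStart`. -/
def rowTime (L : ℕ) : ℕ := forTime L (unaryTime L)

/-- Time for `pairIndex`. -/
def indexTime (L : ℕ) : ℕ := rowTime L + (unaryTime L + 2)

/-- Time for `emitShift`. -/
def shiftTime (L : ℕ) : ℕ := rowTime L + (rowTime L + rowTime L) + 3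

section

variable {S : Store} {n k u r m L : ℕ}

theorem emits_unary {x : Stk} (hx : x ≠ .out) (hx' : x ≠ .tmp) (hS : S x = ones m)
    (htmp : S .tmp = []) (hL : m ≤ L) : Emits (unary x) S S (ones m) (unaryTime L) := by
  rw [← flatMap_range_true]
  exact emits_forEach hx (by decide) hx' hS htmp hL _ fun _ _ _ => Emits.emit true

theorem emits_rowStart {x : Stk} (hx : x ∉ [Stk.out, .tmp, .idx₂, .ress'])
    (hS : S x = ones u) (hress : S .ress' = ones k) (h₂ : S .idx₂ = []) (htmp : S .tmp = [])
    (hu : u ≤ L) (hk : k ≤ L) : Emits (rowStart x) S S (ones (u * k)) (rowTime L) := by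
  simp only [List.mem_cons, List.not_mem_nil, or_false, not_or] at hx
  obtain ⟨h1, h2, h3, h4⟩ := hx
  rw [← flatMap_range_ones]
  refine emits_forEach h1 (by decide) h3 hS h₂ hu _ fun i _ l =>
    emits_unary (by decide) (by decide) ?_ ?_ hk
  · rw [update_of_ne (Ne.symm h4), update_of_ne (by decide), hress]
  · rw [update_of_ne (Ne.symm h2), update_of_ne (by decide), htmp]

theorem emits_pairIndex {x y : Stk} (hx : x ∉ [Stk.out, .tmp, .idx₂, .ress'])
    (hy : y ∉ [Stk.out, .tmp]) (hSx : S x = ones u) (hSy : S y = ones r)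
    (hress : S .ress' = ones k) (h₂ : S .idx₂ = []) (htmp : S .tmp = [])
    (hu : u ≤ L) (hr : r ≤ L) (hk : k ≤ L) :
    Emits (pairIndex x y) S S (natWord (u * k + r)) (indexTime L) := by
  simp only [List.mem_cons, List.not_mem_nil, or_false, not_or] at hy
  rw [natWord_eq, ones_add, List.append_assoc]
  exact (emits_rowStart hx hSx hress h₂ htmp hu hk).seq
    ((emits_unary hy.1 hy.2 hSy htmp hr).seq (emits_emitWord S _))

/-- The stacks as they are when programs for the pair `(u, r)` start. -/
structure Ready (n k u r : ℕ) (S : Store) : Prop where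
  -- `users` and `ress` are left out because they are partly consumed while the loops over the pairs
  -- run.
  users' : S .users' = ones n
  ress' : S .ress' = ones k
  idxU : S .idxU = ones u
  idxR : S .idxR = ones r
  idx₁ : S .idx₁ = []
  idx₂ : S .idx₂ = []
  tmp : S .tmp = []

theorem Ready.emits_total (h : Ready n k u r S) (hn : n ≤ L) (hk : k ≤ L) :
    Emits (rowStart .users') S S (ones (n * k)) (rowTime L) :=
  emits_rowStart (by decide) h.users' h.ress' h.idx₂ h.tmp hn hk

theorem Ready.emits_tripleTotal (h : Ready n k u r S) (hn : n ≤ L) (hk : k ≤ L) :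
    Emits tripleTotal S S (ones (3 * (n * k))) (rowTime L + (rowTime L + rowTime L)) := by
  have := (h.emits_total hn hk).seq ((h.emits_total hn hk).seq (h.emits_total hn hk))
  rwa [← ones_add, ← ones_add, show n * k + (n * k + n * k) = 3 * (n * k) by ring] at this

theorem Ready.emits_shift (h : Ready n k u r S) (hn : n ≤ L) (hk : k ≤ L) :
    Emits emitShift S S (ones (shift n k)) (shiftTime L) := by
  rw [shift, ones_add]
  exact (h.emits_tripleTotal hn hk).seq (emits_emitWord S [true, true])

theorem Ready.emits_pairIndex (h : Ready n k u r S) (hu : u ≤ L) (hr : r ≤ L) (hk : k ≤ L) :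
    Emits (pairIndex .idxU .idxR) S S (natWord (u * k + r)) (indexTime L) :=
  ParamAPEP.emits_pairIndex (by decide) (by decide) h.idxU h.idxR h.ress' h.idx₂ h.tmp hu hr hk

theorem Ready.emits_forResources (h : Ready n k u 0 S) (hS : S .ress = ones k) (hk : k ≤ L)
    {c : Cmd Stk} {t : ℕ} (w : ℕ → List Bool)
    (hc : ∀ r < k, ∀ S', Ready n k u r S' → Emits c S' S' (w r) t) :
    Emits (forEach .ress .idxR c) S S ((List.range k).flatMap w) (forTime L t) :=
  emits_forEach (by decide) (by decide) (by decide) hS h.idxR hk w fun r hr l =>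
    hc r hr _ ⟨by simp [h.users'], by simp [h.ress'], by simp [h.idxU], by simp,
      by simp [h.idx₁], by simp [h.idx₂], by simp [h.tmp]⟩

theorem Ready.emits_forPairs (h : Ready n k 0 0 S) (hSu : S .users = ones n)
    (hSr : S .ress = ones k) (hn : n ≤ L) (hk : k ≤ L)
    {c : Cmd Stk} {t : ℕ} (w : ℕ → ℕ → List Bool)
    (hc : ∀ u < n, ∀ r < k, ∀ S', Ready n k u r S' → Emits c S' S' (w u r) t) :
    Emits (forPairs c) S S ((List.range n).flatMap fun u => (List.range k).flatMap (w u))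
      (forTime L (forTime L t)) :=
  emits_forEach (by decide) (by decide) (by decide) hSu h.idxU hn _ fun u hu l =>
    Ready.emits_forResources (n := n) (u := u)
      ⟨by simp [h.users'], by simp [h.ress'], by simp, by simp [h.idxR, ones_zero],
      by simp [h.idx₁], by simp [h.idx₂], by simp [h.tmp]⟩ (by simp [hSr]) hk _ (hc u hu)

end

/-! ### Programs that emit gates -/

/-- Emits the input gate of a pair. -/
def emitInput : Cmd Stk :=
  -- The first bit announces an entry of the list of gates, the next two are the tag of the gate;
  -- for conjunctions and disjunctions a further `true` announces an argument.
  emitWord [true, false, false] ;; unary .idxU ;; emitWord [false] ;; unary .idxR ;;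
    emitWord [false]

/-- Emits the gate that tells whether a pair is in conflict with one before it. -/
def emitSmaller : Cmd Stk :=
  emitWord [true, true, true] ;;
    forEach .idxU .idx₁ (emitWord [true] ;; pairIndex .idx₁ .idxR) ;;
    forEach .idxR .idx₁ (emitWord [true] ;; pairIndex .idxU .idx₁) ;; emitWord [false]

/-- Emits the gate that tells whether a pair belongs to the relation and is in conflict with one
before it. -/
def emitBoth : Cmd Stk :=
  emitWord [true, true, false, true] ;; pairIndex .idxU .idxR ;; emitWord [true] ;;
    rowStart .users' ;; pairIndex .idxU .idxR ;; emitWord [false]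

/-- Emits the two gates that tell whether there is a conflict. -/
def emitNone : Cmd Stk :=
  emitWord [true, true, true] ;;
    forPairs (emitWord [true] ;; rowStart .users' ;; rowStart .users' ;; pairIndex .idxU .idxR) ;;
    -- These bits end the arguments of the disjunction, announce the next gate, and tag it as a
    -- negation.
    emitWord [false, true, false, true] ;; tripleTotal ;; emitWord [false]

/-- Emits all gates that precede those of the given circuit. -/
def emitFirst : Cmd Stk :=
  forPairs emitInput ;; forPairs emitSmaller ;; forPairs emitBoth ;; emitNone

/-- Time for `emitInput`. -/
def inputTime (L : ℕ) : ℕ := 4 + (unaryTime L + (2 + (unaryTime L + 2)))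

/-- Time for `emitSmaller`. -/
def smallerTime (L : ℕ) : ℕ :=
  4 + (forTime L (2 + indexTime L) + (forTime L (2 + indexTime L) + 2))

/-- Time for `emitBoth`. -/
def bothTime (L : ℕ) : ℕ := 5 + (indexTime L + (2 + (rowTime L + (indexTime L + 2))))

/-- Time for `emitNone`. -/
def noneTime (L : ℕ) : ℕ :=
  4 + (forTime L (forTime L (2 + (rowTime L + (rowTime L + indexTime L)))) +
    (5 + (rowTime L + (rowTime L + rowTime L) + 2)))

/-- Time for `emitFirst`. -/
def firstTime (L : ℕ) : ℕ :=
  forTime L (forTime L (inputTime L)) + (forTime L (forTime L (smallerTime L)) +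
    (forTime L (forTime L (bothTime L)) + noneTime L))

/-- The word of a pair of a user and a resource. -/
def pairWord {n k : ℕ} (p : Fin n × Fin k) : List Bool := natWord p.1.val ++ natWord p.2.val

/-- The word of a gate in the list of gates of a circuit. -/
def entryWord {n k : ℕ} (g : Gate (Fin n × Fin k)) : List Bool := true :: g.word pairWord

section

variable {S : Store} {n k u r L : ℕ}

theorem emits_emitInput (h : Ready n k u r S) (hu : u ≤ L) (hr : r ≤ L) :
    Emits emitInput S S ([true, false, false] ++ natWord u ++ natWord r) (inputTime L) := by
  simp only [natWord_eq, List.append_assoc]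
  exact (emits_emitWord S _).seq <|
    (emits_unary (by decide) (by decide) h.idxU h.tmp hu).seq <|
    (emits_emitWord S _).seq <|
    (emits_unary (by decide) (by decide) h.idxR h.tmp hr).seq (emits_emitWord S _)

theorem emits_emitSmaller (h : Ready n k u r S) (hu : u ≤ L) (hr : r ≤ L) (hk : k ≤ L) :
    Emits emitSmaller S S ([true, true, true] ++ listWord natWord (smaller k u r))
      (smallerTime L) := by
  have h₁ := emits_forEach (cnt := .idxU) (idx := .idx₁) (L := L) (by decide) (by decide)
    (by decide) h.idxU h.idx₁ hu (fun u' => [true] ++ natWord (u' * k + r)) fun u' hu' l =>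
    (emits_emitWord (update (update S .idx₁ (ones u')) .idxU l) [true]).seq
    (emits_pairIndex (x := .idx₁) (y := .idxR) (k := k) (r := r) (u := u')
      (by decide) (by decide) (by simp) (by simp [h.idxR]) (by simp [h.ress'])
      (by simp [h.idx₂]) (by simp [h.tmp]) (hu'.le.trans hu) hr hk)
  have h₂ := emits_forEach (cnt := .idxR) (idx := .idx₁) (L := L) (by decide) (by decide)
    (by decide) h.idxR h.idx₁ hr (fun r' => [true] ++ natWord (u * k + r')) fun r' hr' l =>
    (emits_emitWord (update (update S .idx₁ (ones r')) .idxR l) [true]).seq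
    (emits_pairIndex (x := .idxU) (y := .idx₁) (k := k) (r := r') (u := u)
      (by decide) (by decide) (by simp [h.idxU]) (by simp) (by simp [h.ress'])
      (by simp [h.idx₂]) (by simp [h.tmp]) hu (hr'.le.trans hr) hk)
  have h₃ := (emits_emitWord S [true, true, true]).seq
    (h₁.seq (h₂.seq (emits_emitWord S [false])))
  refine h₃.congr ?_
  simp [smaller, listWord, List.flatMap_append, List.flatMap_map]

theorem emits_emitBoth (h : Ready n k u r S) (hn : n ≤ L) (hu : u ≤ L) (hr : r ≤ L)
    (hk : k ≤ L) :
    Emits emitBoth S S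
      ([true, true, false] ++ listWord natWord [u * k + r, n * k + (u * k + r)])
      (bothTime L) := by
  have h₁ := (emits_emitWord S [true, true, false, true]).seq <|
    (h.emits_pairIndex hu hr hk).seq <| (emits_emitWord S [true]).seq <|
    (h.emits_total hn hk).seq <| (h.emits_pairIndex hu hr hk).seq (emits_emitWord S [false])
  refine h₁.congr ?_
  simp [listWord, natWord_eq, ones_add]

theorem emits_emitNone (h : Ready n k 0 0 S) (hSu : S .users = ones n)
    (hSr : S .ress = ones k) (hn : n ≤ L) (hk : k ≤ L) :
    Emits emitNone S S ([true, true, true] ++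
      ((List.range n).flatMap fun u => (List.range k).flatMap fun r =>
        [true] ++ natWord (2 * (n * k) + (u * k + r))) ++ [false, true, false, true] ++
        natWord (3 * (n * k))) (noneTime L) := by
  have h₁ := h.emits_forPairs hSu hSr hn hk
    (fun u r => [true] ++ (ones (n * k) ++ (ones (n * k) ++ natWord (u * k + r))))
    fun u hu r hr S' h' => (emits_emitWord S' [true]).seq <|
      (h'.emits_total hn hk).seq <| (h'.emits_total hn hk).seq
      (h'.emits_pairIndex (hu.le.trans hn) (hr.le.trans hk) hk)
  have h₂ := (emits_emitWord S [true, true, true]).seq <| h₁.seq <|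
    (emits_emitWord S [false, true, false, true]).seq <|
    (h.emits_tripleTotal hn hk).seq (emits_emitWord S [false])
  refine h₂.congr ?_
  simp only [natWord_eq, ones_add, two_mul, List.append_assoc]

/-- Division with remainder matches the gate numbers `p = u * k + r` with the nested loops of the
program. -/
theorem flatMap_range_mul {α : Type} (n k : ℕ) (f : ℕ → ℕ → List α) :
    (List.range (n * k)).flatMap (fun p => f (p / k) (p % k)) =
      (List.range n).flatMap fun u => (List.range k).flatMap (f u) := by
  induction n with
  | zero => simp
  | succ n ih =>
    rw [Nat.succ_mul, List.range_add, List.flatMap_append, ih, List.range_succ,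
      List.flatMap_append, List.flatMap_map]
    congr 1
    rw [List.flatMap_singleton]
    refine List.flatMap_congr fun r hr => ?_
    have hr : r < k := List.mem_range.mp hr
    have h1 : (n * k + r) / k = n := by
      rw [Nat.mul_comm, Nat.mul_add_div (by omega), Nat.div_eq_of_lt hr, Nat.add_zero]
    have h2 : (n * k + r) % k = r := by
      rw [Nat.mul_comm, Nat.mul_add_mod, Nat.mod_eq_of_lt hr]
    rw [h1, h2]

theorem flatMap_finRange {α : Type} (m : ℕ) (f : ℕ → List α) :
    (List.finRange m).flatMap (fun p => f p.val) = (List.range m).flatMap f := by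
  rw [← List.map_coe_finRange_eq_range, List.flatMap_map]

/-- The words of the gates that precede those of the given circuit. -/
theorem flatMap_entryWord_first (n k : ℕ) :
    (inputGates n k ++ conflictGates n k).flatMap entryWord =
      ((List.range n).flatMap fun u => (List.range k).flatMap fun r =>
        [true, false, false] ++ natWord u ++ natWord r) ++
      (((List.range n).flatMap fun u => (List.range k).flatMap fun r =>
        [true, true, true] ++ listWord natWord (smaller k u r)) ++
      (((List.range n).flatMap fun u => (List.range k).flatMap fun r =>
        [true, true, false] ++ listWord natWord [u * k + r, n * k + (u * k + r)]) ++
      ([true, true, true] ++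
      ((List.range n).flatMap fun u => (List.range k).flatMap fun r =>
        [true] ++ natWord (2 * (n * k) + (u * k + r))) ++ [false, true, false, true] ++
        natWord (3 * (n * k))))) := by
  simp only [← flatMap_range_mul n k, Nat.div_add_mod']
  rw [← flatMap_finRange (n * k) fun p => [true, false, false] ++ natWord (p / k) ++
    natWord (p % k)]
  simp only [inputGates, conflictGates, List.flatMap_append, List.flatMap_map, List.append_assoc]
  refine congrArg₂ _ ?_ ?_
  · refine List.flatMap_congr fun p _ => ?_
    simp [entryWord, Gate.word, pairWord, Fin.divNat, Fin.modNat]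
  · simp [entryWord, Gate.word, listWord, List.flatMap_map]

theorem emits_emitFirst (h : Ready n k 0 0 S) (hSu : S .users = ones n)
    (hSr : S .ress = ones k) (hn : n ≤ L) (hk : k ≤ L) :
    Emits emitFirst S S ((inputGates n k ++ conflictGates n k).flatMap entryWord)
      (firstTime L) := by
  rw [flatMap_entryWord_first]
  exact (h.emits_forPairs hSu hSr hn hk _ fun u hu r hr S' h' =>
      emits_emitInput h' (hu.le.trans hn) (hr.le.trans hk)).seq <|
    (h.emits_forPairs hSu hSr hn hk _ fun u hu r hr S' h' =>
      emits_emitSmaller h' (hu.le.trans hn) (hr.le.trans hk) hk).seq <|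
    (h.emits_forPairs hSu hSr hn hk _ fun u hu r hr S' h' =>
      emits_emitBoth h' hn (hu.le.trans hn) (hr.le.trans hk) hk).seq <|
    emits_emitNone h hSu hSr hn hk

end

end ParamAPEP

/-! ### Translating the given circuit and assembling the instances -/

namespace ParamAPEP

open Function

/-! ### Programs that copy the given circuit -/

/-- Removes all ones from the top of a stack, and a zero that follows. -/
def clear (x : Stk) : Cmd Stk := .loop x .skip

/-- Copies a gate number and adds `shift n k`. -/
def copyIndex : Cmd Stk := emitShift ;; .loop .inp (.push .out true) ;; emitWord [false]

/-- Copies a list of gate numbers and adds `shift n k` to each. -/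
def copyList : Cmd Stk := .loop .inp (emitWord [true] ;; copyIndex) ;; emitWord [false]

/-- Reads the number of a variable and emits the disjunction of its pairs. -/
def copyVar : Cmd Stk :=
  .loop .inp (.push .idxU true) ;; emitWord [true, true, true] ;;
    forEach .ress .idxR (emitWord [true] ;; pairIndex .idxU .idxR) ;; emitWord [false] ;;
    clear .idxU

/-- Reads a gate and emits the corresponding gate of the new circuit. -/
def copyGate : Cmd Stk :=
  .ifpop .inp
    (.ifpop .inp (emitWord [true, true, true] ;; copyList) (emitWord [true, true, false] ;; copyList))
    (.ifpop .inp (emitWord [true, false, true] ;; copyIndex) copyVar)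

/-- Copies and counts the gates. -/
def copyGates : Cmd Stk := .loop .inp (.push .gates true ;; copyGate)

/-- Emits the last gate of the new circuit. -/
def emitLast (negate : Bool) : Cmd Stk :=
  if negate then emitWord [true, false, true] ;; emitShift ;; unary .gates ;; emitWord [false]
  else emitWord [true, true, false, true] ;; emitShift ;; unary .gates ;; emitWord [false, false]

/-- Reads the output of the given circuit and emits the rest of the new one. -/
def emitEnd (negate : Bool) : Cmd Stk :=
  -- Both uses of `ifpop` here only discard a bit of the list of outputs: first the announcement of
  -- its entry, later its end.
  .ifpop .inp .skip .skip ;; emitWord [true, true, false, true] ;; tripleTotal ;;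
    -- The first bit raises `3 * n * k` to the number of the gate for "no conflict"; the others end
    -- this number and announce the second argument, the shifted output of the given circuit.
    emitWord [true, false, true] ;; copyIndex ;; emitWord [false] ;; .ifpop .inp .skip .skip ;;
    emitLast negate ;; emitWord [false, true] ;; emitShift ;; unary .gates ;;
    -- The extra one yields the number of the last gate, which is the output; the zeros end the
    -- number and the list of outputs.
    emitWord [true, false, false]

/-- Reads a circuit and emits the new circuit. -/
def emitCircuit (negate : Bool) : Cmd Stk := emitFirst ;; copyGates ;; emitEnd negate

/-- Reads the numbers `k` and `n` and emits the beginning of the new instance. -/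
def emitSizes : Cmd Stk :=
  -- The input begins with the parameter `k` and then `n`. The output begins with the parameter `k`,
  -- then `n` and again `k`, so `k` is echoed while it is read.
  .loop .inp (.push .ress true ;; .push .ress' true ;; .push .out true) ;; emitWord [false] ;;
    .loop .inp (.push .users true ;; .push .users' true) ;; unary .users ;; emitWord [false] ;;
    unary .ress ;; emitWord [false]

/-- Clears all stacks that are still in use. -/
def cleanup : Cmd Stk :=
  clear .users ;; clear .users' ;; clear .ress ;; clear .ress' ;; clear .gates

/-- The program for APEP. -/
def apepBody : Cmd Stk :=
  -- The base relation contains all pairs, so its table consists of `n * k` ones.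
  emitSizes ;; rowStart .users' ;; emitWord [true] ;; emitCircuit false ;; emitWord [false] ;;
    cleanup

/-- The program for Valued APEP. -/
def valuedBody : Cmd Stk :=
  emitSizes ;; emitWord [true] ;; emitCircuit true ;; emitWord [false] ;;
    -- Two zeros are the word of a circuit with no gates and no outputs; the last zero is the budget
    -- `0` in binary.
    forEach .users .idxU (emitWord [false, false]) ;; emitWord [false] ;; cleanup

/-- Runs a program that reads the stack `inp` and emits its output. -/
def wrap (c : Cmd Stk) : Cmd Stk := .pour .io .inp ;; c ;; .pour .out .io

/-- Time for a loop that reads a number. -/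
def readTime (L : ℕ) : ℕ := L * 4 + 1

/-- Time for `copyIndex`. -/
def copyTime (L : ℕ) : ℕ := shiftTime L + (readTime L + 2)

/-- Time for `copyList`. -/
def listTime (L : ℕ) : ℕ := L * (2 + copyTime L + 1) + 1 + 2

/-- Time for `copyVar`. -/
def varTime (L : ℕ) : ℕ :=
  readTime L + (4 + (forTime L (2 + indexTime L) + (2 + readTime L)))

/-- Time for `copyGate`. -/
def gateTime (L : ℕ) : ℕ := listTime L + copyTime L + varTime L + 6

/-- Time for `copyGates`. -/
def gatesTime (L : ℕ) : ℕ := L * (1 + gateTime L + 1) + 1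

/-- Time for `emitLast`. -/
def lastTime (L : ℕ) : ℕ := 5 + (shiftTime L + (unaryTime L + 3))

/-- Time for `emitEnd`. -/
def endTime (L : ℕ) : ℕ :=
  2 + (5 + (rowTime L + (rowTime L + rowTime L) + (4 + (copyTime L + (2 + (2 + (lastTime L +
    (3 + (shiftTime L + (unaryTime L + 4))))))))))

/-- Time for `emitCircuit`. -/
def circuitTime (L : ℕ) : ℕ := firstTime L + (gatesTime L + endTime L)

/-- Time for `emitSizes`. -/
def sizesTime (L : ℕ) : ℕ :=
  readTime L + (2 + (readTime L + (unaryTime L + (2 + (unaryTime L + 2)))))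

/-- Time for `cleanup`. -/
def cleanupTime (L : ℕ) : ℕ :=
  readTime L + (readTime L + (readTime L + (readTime L + readTime L)))

/-- Time for `apepBody`. -/
def apepTime (L : ℕ) : ℕ :=
  sizesTime L + (rowTime L + (2 + (circuitTime L + (2 + cleanupTime L))))

/-- Time for `valuedBody`. -/
def valuedTime (L : ℕ) : ℕ :=
  sizesTime L + (2 + (circuitTime L + (2 + (forTime L 3 + (2 + cleanupTime L)))))

/-! ### The stacks between the parts of the program -/

/-- The stacks when `n`, `k` and `g` gates have been read, the stack `idxU` holds `i`, and `l` is
the rest of the input. -/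
def store (n k g i : ℕ) (l : List Bool) : Store
  | .inp => l
  | .users => ones n
  | .users' => ones n
  | .ress => ones k
  | .ress' => ones k
  | .gates => ones g
  | .idxU => ones i
  | _ => []

section

variable (n k g i : ℕ) (l l' : List Bool)

theorem update_store_inp : update (store n k g i l) .inp l' = store n k g i l' := by
  funext x; cases x <;> simp [store]

theorem update_store_gates : update (store n k g i l) .gates (ones m) = store n k m i l := by
  funext x; cases x <;> simp [store]

theorem update_store_idxU : update (store n k g i l) .idxU (ones m) = store n k g m l := by
  funext x; cases x <;> simp [store]

theorem update_store_users :
    update (update (store n k g i l) .users (ones m)) .users' (ones m) = store m k g i l := by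
  funext x; cases x <;> simp [store]

theorem update_store_ress :
    update (update (store n k g i l) .ress (ones m)) .ress' (ones m) = store n m g i l := by
  funext x; cases x <;> simp [store]

theorem ready_store : Ready n k i 0 (store n k g i l) := ⟨rfl, rfl, rfl, rfl, rfl, rfl, rfl⟩

end

section

variable {n k g i L : ℕ} {l : List Bool}

/-- Reads a number. -/
theorem emits_read {c : Cmd Stk} {F : ℕ → Store} (m : ℕ) (hm : m ≤ L) (w : ℕ → List Bool)
    (h : ∀ j < m, ∀ r, Emits c (update (F j) .inp r) (update (F (j + 1)) .inp r) (w j) 3) :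
    Emits (.loop .inp c) (update (F 0) .inp (natWord m ++ l)) (update (F m) .inp l)
      ((List.range m).flatMap w) (readTime L) := by
  have := Emits.loop (x := .inp) (c := c) (by decide) (fun _ => []) w 3
    (rest := false :: l) (by simp) (List.range m) F (fun j z r hz => by
      obtain ⟨hj, rfl⟩ := List.getElem?_eq_some_iff.mp hz
      rw [List.length_range] at hj
      simpa using h j hj r)
  rw [flatMap_range_true, List.length_range] at this
  rw [natWord_eq, List.append_assoc]
  exact this.mono (by unfold readTime; omega)

theorem emits_clear {S : Store} {x : Stk} {m : ℕ} (hx : x ≠ .out) (hS : S x = ones m)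
    (hm : m ≤ L) : Emits (clear x) S (update S x []) [] (readTime L) := by
  have := Emits.loop (x := x) (c := .skip) hx (fun _ => []) (fun _ => []) 1
    (rest := []) (by simp) (List.range m) (fun _ => S) (fun _ _ _ _ => Emits.skip)
  rw [flatMap_range_true, List.length_range, List.append_nil, ← hS, update_eq_self] at this
  refine (this.mono ?_).congr ?_
  · unfold readTime; omega
  · simp

theorem emits_copyIndex (hn : n ≤ L) (hk : k ≤ L) {j : ℕ} (hj : j ≤ L) :
    Emits copyIndex (store n k g 0 (natWord j ++ l)) (store n k g 0 l)
      (natWord (shift n k + j)) (copyTime L) := by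
  have h := emits_read (l := l) (F := fun _ => store n k g 0 []) j hj (fun _ => [true])
    fun _ _ r => (Emits.emit true).mono (by decide)
  rw [update_store_inp, update_store_inp, flatMap_range_true] at h
  rw [natWord_eq (shift n k + j), ones_add, List.append_assoc]
  exact ((ready_store n k g 0 _).emits_shift hn hk).seq (h.seq (emits_emitWord _ _))

theorem emits_copyList (hn : n ≤ L) (hk : k ≤ L) {js : List ℕ} (hjs : ∀ j ∈ js, j ≤ L)
    (hlen : js.length ≤ L) :
    Emits copyList (store n k g 0 (listWord natWord js ++ l)) (store n k g 0 l)
      (listWord natWord (js.map fun j => shift n k + j)) (listTime L) := by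
  have h := Emits.loop (x := .inp) (c := emitWord [true] ;; copyIndex) (by decide) natWord
    (fun j => [true] ++ natWord (shift n k + j)) (2 + copyTime L)
    (rest := false :: l) (by simp) js (fun _ => store n k g 0 []) (fun i j r hj => by
      simp only [update_store_inp]
      exact (emits_emitWord _ [true]).seq
        (emits_copyIndex hn hk (hjs j (List.mem_of_getElem? hj))))
  rw [update_store_inp, update_store_inp] at h
  have h' := h.seq (emits_emitWord _ [false])
  unfold listWord
  rw [List.append_assoc, List.flatMap_map]
  refine h'.mono ?_
  have := Nat.mul_le_mul_right (2 + copyTime L + 1) hlen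
  simpa [listTime] using this

theorem emits_copyVar (hn : n ≤ L) (hk : k ≤ L) (u : Fin n) :
    Emits copyVar (store n k g 0 (natWord u ++ l)) (store n k g 0 l)
      (entryWord (liftGate n k (.input u))) (varTime L) := by
  have hu : u.val ≤ L := u.isLt.le.trans hn
  have h := emits_read (l := l) (F := fun i => store n k g i []) (c := .push .idxU true)
    u.val hu (fun _ => []) fun j _ r => by
      have := Emits.push (x := .idxU) (S := store n k g j r) (by decide) true
      rw [show store n k g j r .idxU = ones j from rfl, ← ones_succ, update_store_idxU] at this
      simp only [update_store_inp]
      exact this.mono (by decide)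
  rw [update_store_inp, update_store_inp] at h
  have h₂ := (ready_store n k g u l).emits_forResources (L := L) rfl hk
    (c := emitWord [true] ;; pairIndex .idxU .idxR) (t := 2 + indexTime L)
    (fun r => [true] ++ natWord (u * k + r)) fun r hr S' h' =>
      (emits_emitWord S' [true]).seq (h'.emits_pairIndex hu (hr.le.trans hk) hk)
  have h₃ := emits_clear (S := store n k g u l) (x := .idxU) (by decide) rfl hu
  rw [← ones_zero, update_store_idxU] at h₃
  refine (h.seq <| (emits_emitWord _ [true, true, true]).seq <| h₂.seq <|
    (emits_emitWord _ [false]).seq h₃).congr ?_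
  have hnil : (List.range u).flatMap (fun _ => ([] : List Bool)) = [] :=
    List.flatMap_eq_nil_iff.mpr fun _ _ => rfl
  simp [entryWord, liftGate, Gate.word, listWord, List.flatMap_map, hnil, ones_zero]

/-- Numbers are written in unary, so the word bounds both the number of entries and their values;
this keeps the copying loops polynomial. -/
theorem length_listWord_natWord (js : List ℕ) :
    js.length ≤ (listWord natWord js).length ∧
      ∀ j ∈ js, j ≤ (listWord natWord js).length := by
  have h : (listWord natWord js).length = (js.map fun j => j + 2).sum + 1 := by
    simp [listWord, natWord, List.length_flatMap, Nat.add_assoc]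
  rw [h]
  constructor
  · have := List.length_le_sum_of_one_le (js.map fun j => j + 2) (by simp)
    simp only [List.length_map] at this
    omega
  · intro j hj
    have := List.single_le_sum (l := js.map fun j => j + 2) (by simp) _
      (List.mem_map_of_mem hj)
    omega

theorem emits_copyGate (hn : n ≤ L) (hk : k ≤ L) (gt : Gate (Fin n))
    (hgt : (gt.word fun u => natWord u.val).length ≤ L) :
    Emits copyGate (store n k g 0 (gt.word (fun u => natWord u.val) ++ l)) (store n k g 0 l)
      (entryWord (liftGate n k gt)) (gateTime L) := by
  -- The two nested `ifpop` commands read the two-bit tag, so each kind of gate follows its own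
  -- branch.
  cases gt with
  | input u =>
    refine (Emits.ifpop_false (by decide) rfl ?_).mono
      (show varTime L + 1 + 1 ≤ gateTime L by unfold gateTime; omega)
    rw [update_store_inp]
    refine Emits.ifpop_false (by decide) rfl ?_
    rw [update_store_inp]
    exact emits_copyVar hn hk u
  | neg j =>
    refine (Emits.ifpop_false (by decide) rfl ?_).mono
      (show 4 + copyTime L + 1 + 1 ≤ gateTime L by unfold gateTime; omega)
    rw [update_store_inp]
    refine Emits.ifpop_true (by decide) rfl ?_
    rw [update_store_inp]
    refine ((emits_emitWord _ [true, false, true]).seq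
      (emits_copyIndex hn hk (j := j) ?_)).congr rfl
    simp [Gate.word, natWord] at hgt
    omega
  | conj js =>
    refine (Emits.ifpop_true (by decide) rfl ?_).mono
      (show 4 + listTime L + 1 + 1 ≤ gateTime L by unfold gateTime; omega)
    rw [update_store_inp]
    refine Emits.ifpop_false (by decide) rfl ?_
    rw [update_store_inp]
    have hlen := length_listWord_natWord js
    have hle : (listWord natWord js).length ≤ L := by simp [Gate.word] at hgt; omega
    exact ((emits_emitWord _ [true, true, false]).seq
      (emits_copyList hn hk (fun j hj => (hlen.2 j hj).trans hle) (hlen.1.trans hle))).congr rfl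
  | disj js =>
    refine (Emits.ifpop_true (by decide) rfl ?_).mono
      (show 4 + listTime L + 1 + 1 ≤ gateTime L by unfold gateTime; omega)
    rw [update_store_inp]
    refine Emits.ifpop_true (by decide) rfl ?_
    rw [update_store_inp]
    have hlen := length_listWord_natWord js
    have hle : (listWord natWord js).length ≤ L := by simp [Gate.word] at hgt; omega
    exact ((emits_emitWord _ [true, true, true]).seq
      (emits_copyList hn hk (fun j hj => (hlen.2 j hj).trans hle) (hlen.1.trans hle))).congr rfl

theorem emits_copyGates (hn : n ≤ L) (hk : k ≤ L) (gs : List (Gate (Fin n)))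
    (hgs : (listWord (Gate.word fun u : Fin n => natWord u.val) gs).length ≤ L) :
    Emits copyGates
      (store n k 0 0 (listWord (Gate.word fun u : Fin n => natWord u.val) gs ++ l))
      (store n k gs.length 0 l) ((gs.map (liftGate n k)).flatMap entryWord) (gatesTime L) := by
  have hsum : (listWord (Gate.word fun u : Fin n => natWord u.val) gs).length =
      (gs.map fun gt => (gt.word fun u => natWord u.val).length + 1).sum + 1 := by
    simp [listWord, List.length_flatMap]
  have hlen : gs.length ≤ L := by
    have := List.length_le_sum_of_one_le
      (gs.map fun gt => (gt.word fun u => natWord u.val).length + 1) (by simp)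
    simp only [List.length_map] at this
    omega
  have hmem : ∀ gt ∈ gs, (gt.word fun u => natWord u.val).length ≤ L := by
    intro gt hgt
    have := List.single_le_sum
      (l := gs.map fun gt => (gt.word fun u => natWord u.val).length + 1) (by simp) _
      (List.mem_map_of_mem hgt)
    omega
  have h := Emits.loop (x := .inp) (c := .push .gates true ;; copyGate) (by decide)
    (Gate.word fun u : Fin n => natWord u.val) (fun gt => entryWord (liftGate n k gt))
    (1 + gateTime L) (rest := false :: l) (by simp) gs (fun i => store n k i 0 [])
    (fun i gt r hgt => by
      simp only [update_store_inp]
      have h₁ := Emits.push (x := .gates)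
        (S := store n k i 0 (gt.word (fun u => natWord u.val) ++ r)) (by decide) true
      rw [show store n k i 0 (gt.word (fun u => natWord u.val) ++ r) .gates = ones i from rfl,
        ← ones_succ, update_store_gates] at h₁
      exact h₁.seq (emits_copyGate hn hk gt (hmem gt (List.mem_of_getElem? hgt))))
  rw [update_store_inp, update_store_inp] at h
  rw [List.flatMap_map]
  unfold listWord
  rw [List.append_assoc]
  refine h.mono ?_
  have := Nat.mul_le_mul_right (1 + gateTime L + 1) hlen
  simpa [gatesTime] using this

theorem emits_emitLast (negate : Bool) (hn : n ≤ L) (hk : k ≤ L) (hg : g ≤ L) :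
    Emits (emitLast negate) (store n k g 0 l) (store n k g 0 l)
      (entryWord (n := n) (k := k) (lastGate negate (shift n k + g))) (lastTime L) := by
  have hs := (ready_store n k g 0 l).emits_shift hn hk
  have hu : Emits (unary .gates) (store n k g 0 l) (store n k g 0 l) (ones g) (unaryTime L) :=
    emits_unary (by decide) (by decide) rfl rfl hg
  cases negate
  · refine (((emits_emitWord _ [true, true, false, true]).seq <| hs.seq <| hu.seq <|
      emits_emitWord _ [false, false]).congr ?_).mono ?_
    · simp [entryWord, lastGate, Gate.word, listWord, natWord_eq, ones_add]
    · simp [lastTime]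
  · refine (((emits_emitWord _ [true, false, true]).seq <| hs.seq <| hu.seq <|
      emits_emitWord _ [false]).congr ?_).mono ?_
    · simp [entryWord, lastGate, Gate.word, natWord_eq, ones_add]
    · simp [lastTime]; omega

theorem emits_emitEnd (negate : Bool) (hn : n ≤ L) (hk : k ≤ L) (hg : g ≤ L) {o : ℕ}
    (ho : o ≤ L) :
    Emits (emitEnd negate) (store n k g 0 (listWord natWord [o])) (store n k g 0 [])
      ([.conj [3 * (n * k) + 1, shift n k + o], lastGate negate (shift n k + g)].flatMap
        (entryWord (n := n) (k := k)) ++ [false] ++ listWord natWord [shift n k + g + 1])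
      (endTime L) := by
  have h₁ : Emits (.ifpop .inp .skip .skip) (store n k g 0 (listWord natWord [o]))
      (store n k g 0 (natWord o ++ [false])) [] 2 := by
    refine Emits.ifpop_true (l := natWord o ++ [false]) (by decide) ?_ ?_
    · simp [store, listWord]
    · rw [update_store_inp]; exact Emits.skip
  have h₂ : Emits (.ifpop .inp .skip .skip) (store n k g 0 [false])
      (store n k g 0 []) [] 2 := by
    refine Emits.ifpop_false (l := []) (by decide) rfl ?_
    rw [update_store_inp]; exact Emits.skip
  refine (h₁.seq <| (emits_emitWord _ [true, true, false, true]).seq <|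
    ((ready_store n k g 0 _).emits_tripleTotal hn hk).seq <|
    (emits_emitWord _ [true, false, true]).seq <|
    (emits_copyIndex hn hk ho).seq <| (emits_emitWord _ [false]).seq <| h₂.seq <|
    (emits_emitLast negate hn hk hg).seq <| (emits_emitWord _ [false, true]).seq <|
    ((ready_store n k g 0 _).emits_shift hn hk).seq <|
    (emits_unary (by decide) (by decide) rfl rfl hg).seq
    (emits_emitWord _ [true, false, false])).congr ?_
  simp [entryWord, Gate.word, listWord, natWord_eq, ones_add, ones_one]

theorem emits_emitCircuit (negate : Bool) (hn : n ≤ L) (hk : k ≤ L)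
    (C : DecisionCircuit (Fin n)) (hC : (C.word fun u => natWord u.val).length ≤ L) :
    Emits (emitCircuit negate) (store n k 0 0 (C.word fun u => natWord u.val))
      (store n k C.gates.length 0 []) ((sparseCircuit k C negate).word pairWord)
      (circuitTime L) := by
  have hword : C.word (fun u => natWord u.val) =
      listWord (Gate.word fun u : Fin n => natWord u.val) C.gates ++ listWord natWord [C.out] := by
    rw [Circuit.word, C.outs_eq]
  rw [hword, List.length_append] at hC
  rw [hword]
  have hlen : C.gates.length ≤ L := by
    have := List.length_le_sum_of_one_le
      (C.gates.map fun gt => (gt.word fun u => natWord u.val).length + 1) (by simp)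
    simp only [List.length_map] at this
    simp [listWord, List.length_flatMap] at hC
    omega
  refine (((emits_emitFirst (ready_store n k 0 0 _) rfl rfl hn hk).seq <|
    (emits_copyGates hn hk C.gates (by omega)).seq
    (emits_emitEnd negate hn hk hlen (C.out_lt.le.trans hlen)))).congr ?_
  simp [Circuit.word, sparseCircuit, sparseGates, listWord, entryWord]
  rfl

theorem emits_emitSizes (hn : n ≤ L) (hk : k ≤ L) :
    Emits emitSizes (store 0 0 0 0 (natWord k ++ (natWord n ++ l))) (store n k 0 0 l)
      (natWord k ++ (natWord n ++ natWord k)) (sizesTime L) := by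
  have h₁ := emits_read (l := natWord n ++ l) (F := fun i => store 0 i 0 0 [])
    (c := .push .ress true ;; .push .ress' true ;; .push .out true) k hk
    (fun _ => [true]) fun j _ r => by
      simp only [update_store_inp]
      have := (Emits.push (x := .ress) (S := store 0 j 0 0 r) (by decide) true).seq
        ((Emits.push (x := .ress') (by decide) true).seq (Emits.emit true))
      rw [update_of_ne (by decide), show store 0 j 0 0 r .ress = ones j from rfl,
        show store 0 j 0 0 r .ress' = ones j from rfl, ← ones_succ, update_store_ress] at this
      exact this
  have h₂ := emits_read (l := l) (F := fun i => store i k 0 0 [])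
    (c := .push .users true ;; .push .users' true) n hn
    (fun _ => []) fun j _ r => by
      simp only [update_store_inp]
      have := (Emits.push (x := .users) (S := store j k 0 0 r) (by decide) true).seq
        (Emits.push (x := .users') (by decide) true)
      rw [update_of_ne (by decide), show store j k 0 0 r .users = ones j from rfl,
        show store j k 0 0 r .users' = ones j from rfl, ← ones_succ, update_store_users] at this
      exact this.mono (by decide)
  simp only [update_store_inp] at h₁ h₂
  refine (h₁.seq <| (emits_emitWord _ [false]).seq <| h₂.seq <|
    (emits_unary (x := .users) (by decide) (by decide) rfl rfl hn).seq <|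
    (emits_emitWord _ [false]).seq <|
    (emits_unary (x := .ress) (by decide) (by decide) rfl rfl hk).seq
    (emits_emitWord _ [false])).congr ?_
  rw [flatMap_range_true]
  simp [natWord_eq]

theorem emits_cleanup (hn : n ≤ L) (hk : k ≤ L) (hg : g ≤ L) :
    Emits cleanup (store n k g 0 []) (fun _ => []) [] (cleanupTime L) := by
  have h := (emits_clear (S := store n k g 0 []) (x := .users) (by decide) rfl hn).seq <|
    (emits_clear (x := .users') (by decide) (by simp [store]) hn).seq <|
    (emits_clear (x := .ress) (by decide) (by simp [store]) hk).seq <|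
    (emits_clear (x := .ress') (by decide) (by simp [store]) hk).seq
    (emits_clear (x := .gates) (by decide) (by simp [store]) hg)
  have e : update (update (update (update (update (store n k g 0 []) .users []) .users' [])
      .ress []) .ress' []) .gates [] = fun _ => [] := by
    funext x; cases x <;> simp [store, ones_zero]
  rw [e] at h
  exact h

end

end ParamAPEP

/-! ### Running times, the complete program, and hardness -/

namespace ParamAPEP

open Function

/-! ### Polynomial bounds -/

/-- The function is bounded by a polynomial. -/
def PolyBound (f : ℕ → ℕ) : Prop := ∃ a e : ℕ, ∀ L, f L ≤ a * (L + 1) ^ e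

namespace PolyBound

variable {f g : ℕ → ℕ}

theorem const (m : ℕ) : PolyBound fun _ => m := ⟨m, 0, fun _ => by simp⟩

theorem id : PolyBound fun L => L := ⟨1, 1, fun _ => by simp⟩

theorem add (hf : PolyBound f) (hg : PolyBound g) : PolyBound fun L => f L + g L := by
  obtain ⟨a, e, hf⟩ := hf
  obtain ⟨b, d, hg⟩ := hg
  refine ⟨a + b, e + d, fun L => ?_⟩
  have h1 : (L + 1) ^ e ≤ (L + 1) ^ (e + d) := Nat.pow_le_pow_right (by omega) (by omega)
  have h2 : (L + 1) ^ d ≤ (L + 1) ^ (e + d) := Nat.pow_le_pow_right (by omega) (by omega)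
  calc f L + g L ≤ a * (L + 1) ^ e + b * (L + 1) ^ d := Nat.add_le_add (hf L) (hg L)
    _ ≤ a * (L + 1) ^ (e + d) + b * (L + 1) ^ (e + d) := by gcongr
    _ = _ := by ring

theorem mul (hf : PolyBound f) (hg : PolyBound g) : PolyBound fun L => f L * g L := by
  obtain ⟨a, e, hf⟩ := hf
  obtain ⟨b, d, hg⟩ := hg
  refine ⟨a * b, e + d, fun L => ?_⟩
  calc f L * g L ≤ (a * (L + 1) ^ e) * (b * (L + 1) ^ d) := Nat.mul_le_mul (hf L) (hg L)
    _ = _ := by ring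

theorem forTime (hf : PolyBound f) : PolyBound fun L => ParamAPEP.forTime L (f L) :=
  ((id.mul (hf.add (const 2))).add id).add (const 2)

theorem unaryTime : PolyBound unaryTime := (const 1).forTime

theorem rowTime : PolyBound rowTime := unaryTime.forTime

theorem indexTime : PolyBound indexTime := rowTime.add (unaryTime.add (const 2))

theorem shiftTime : PolyBound shiftTime := (rowTime.add (rowTime.add rowTime)).add (const 3)

theorem firstTime : PolyBound firstTime := by
  have hi : PolyBound inputTime :=
    (const 4).add (unaryTime.add ((const 2).add (unaryTime.add (const 2))))
  have hf : PolyBound fun L => ParamAPEP.forTime L (2 + ParamAPEP.indexTime L) :=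
    ((const 2).add indexTime).forTime
  have hs : PolyBound smallerTime := (const 4).add (hf.add (hf.add (const 2)))
  have hb : PolyBound bothTime :=
    (const 5).add (indexTime.add ((const 2).add (rowTime.add (indexTime.add (const 2)))))
  have hn : PolyBound noneTime :=
    (const 4).add (((((const 2).add (rowTime.add (rowTime.add indexTime))).forTime).forTime).add
      ((const 5).add ((rowTime.add (rowTime.add rowTime)).add (const 2))))
  exact hi.forTime.forTime.add (hs.forTime.forTime.add (hb.forTime.forTime.add hn))

theorem readTime : PolyBound readTime := (id.mul (const 4)).add (const 1)

theorem copyTime : PolyBound copyTime := shiftTime.add (readTime.add (const 2))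

theorem circuitTime : PolyBound circuitTime := by
  have hl : PolyBound listTime :=
    ((id.mul (((const 2).add copyTime).add (const 1))).add (const 1)).add (const 2)
  have hv : PolyBound varTime := readTime.add ((const 4).add
    ((((const 2).add indexTime).forTime).add ((const 2).add readTime)))
  have hg : PolyBound gateTime := ((hl.add copyTime).add hv).add (const 6)
  have hgs : PolyBound gatesTime := (id.mul (((const 1).add hg).add (const 1))).add (const 1)
  have hla : PolyBound lastTime := (const 5).add (shiftTime.add (unaryTime.add (const 3)))
  have he : PolyBound endTime := (const 2).add ((const 5).add
    ((rowTime.add (rowTime.add rowTime)).add ((const 4).add (copyTime.add ((const 2).add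
    ((const 2).add (hla.add ((const 3).add (shiftTime.add (unaryTime.add (const 4)))))))))))
  exact firstTime.add (hgs.add he)

theorem sizesTime : PolyBound sizesTime := readTime.add ((const 2).add (readTime.add
  (unaryTime.add ((const 2).add (unaryTime.add (const 2))))))

theorem cleanupTime : PolyBound cleanupTime :=
  readTime.add (readTime.add (readTime.add (readTime.add readTime)))

theorem apepTime : PolyBound apepTime := sizesTime.add (rowTime.add ((const 2).add
  (circuitTime.add ((const 2).add cleanupTime))))

theorem valuedTime : PolyBound valuedTime := sizesTime.add ((const 2).add
  (circuitTime.add ((const 2).add ((const 3).forTime.add ((const 2).add cleanupTime)))))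

end PolyBound

/-! ### The whole program -/

/-- A single step pushes at most one bit. Hence the output is no longer than the running time, which
bounds the final `pour` in `wrap`. -/
theorem Cmd.Runs.length_le {K : Type} [DecidableEq K] {c : Cmd K} {S S' : K → List Bool} {t : ℕ}
    (h : Runs c S t S') (x : K) : (S' x).length ≤ (S x).length + t := by
  have hpop : ∀ (S : K → List Bool) (k : K), (update S k (S k).tail x).length ≤ (S x).length := by
    intro S k
    by_cases hx : x = k
    · subst hx; simp
    · simp [hx]
  have hpush : ∀ (S : K → List Bool) (k : K) (b : Bool),
      (update S k (b :: S k) x).length ≤ (S x).length + 1 := by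
    intro S k b
    by_cases hx : x = k
    · subst hx; simp
    · simp [hx]
  induction h with
  | skip S => omega
  | push k b S => exact hpush S k b
  | pour_nil k k' S hk =>
    have := hpop S k
    rw [hk] at this
    exact this.trans (Nat.le_succ _)
  | pour_cons k k' S t S' b l hk _ ih =>
    have h1 := hpop S k
    rw [hk, List.tail_cons] at h1
    have h2 := hpush (update S k l) k' b
    omega
  | seq _ _ ih₁ ih₂ => omega
  | @ifpop_true k c d S t S' hk _ ih => have := hpop S k; omega
  | @ifpop_false k c d S t S' hk _ ih => have := hpop S k; omega
  | @loop_true k c S t S' t' S'' hk _ _ ih₁ ih₂ => have := hpop S k; omega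
  | @loop_false k c S hk => exact (hpop S k).trans (Nat.le_succ _)

theorem Emits.length_le {c : Cmd Stk} {S S' : Store} {w : List Bool} {t : ℕ}
    (h : Emits c S S' w t) : w.length ≤ t := by
  obtain ⟨s, hs, hr⟩ := h []
  have := hr.length_le .out
  simp at this
  omega

/-- The input arrives reversed on `io`, and pouring it to `inp` restores its order; the last `pour`
does the same for the output, which is kept reversed. -/
theorem runs_wrap {c : Cmd Stk} {w w' : List Bool} {t : ℕ}
    (h : Emits c (store 0 0 0 0 w) (fun _ => []) w' t) :
    ∃ t' ≤ w.length + 1 + (t + (t + 1)), Cmd.Runs (wrap c) (update (fun _ => []) .io w.reverse) t'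
      (update (fun _ => []) .io w') := by
  have hlen := h.length_le
  obtain ⟨s, hs, hr⟩ := h []
  have h₁ := runs_pour .io .inp (by decide) w.reverse (update (fun _ => []) .io w.reverse) (by simp)
  have e₁ : update (update (update (fun _ : Stk => ([] : List Bool)) .io w.reverse) .io [])
      Stk.inp (w.reverse.reverse ++ update (fun _ : Stk => []) .io w.reverse Stk.inp) =
      update (store 0 0 0 0 w) .out [] := by
    funext x; cases x <;> simp [store, ones_zero]
  rw [e₁] at h₁
  have h₂ := runs_pour .out .io (by decide) (w'.reverse ++ [])
    (update (fun _ => []) .out (w'.reverse ++ [])) (by simp)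
  have e₂ : update (update (update (fun _ : Stk => ([] : List Bool)) .out (w'.reverse ++ []))
      .out []) Stk.io ((w'.reverse ++ []).reverse ++
        update (fun _ : Stk => []) .out (w'.reverse ++ []) Stk.io) =
      update (fun _ => []) .io w' := by
    funext x; cases x <;> simp
  rw [e₂] at h₂
  refine ⟨_, ?_, h₁.seq (hr.seq h₂)⟩
  simp only [List.length_append, List.length_reverse, List.length_nil]
  omega

section

variable {L : ℕ} (I : WCSInstance)

/-- The word of the given circuit. -/
def circuitWord : List Bool := I.circuit.word fun u => natWord u.val

/-- The word of the instance of weighted circuit satisfiability. -/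
def wcsWord : List Bool := natWord I.weight ++ (natWord I.numVars ++ circuitWord I)

theorem length_wcsWord :
    (wcsWord I).length = I.weight + 1 + (I.numVars + 1 + (circuitWord I).length) := by
  simp [wcsWord, natWord]
  omega

theorem length_gates_le : I.circuit.gates.length ≤ (circuitWord I).length := by
  have := List.length_le_sum_of_one_le
    (I.circuit.gates.map fun gt => (gt.word fun u => natWord u.val).length + 1) (by simp)
  simp only [List.length_map] at this
  simp [circuitWord, Circuit.word, listWord, List.length_flatMap]
  omega

/-- The beginning of the word of the new instance. -/
def sizesWord : List Bool := natWord I.weight ++ (natWord I.numVars ++ natWord I.weight)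

/-- The word of the constraint of the new instance. -/
def constraintWord (negate : Bool) : List Bool :=
  (sparseCircuit I.weight I.circuit negate).word pairWord

theorem apep_word_apepOf : apep.word (apepOf I) = sizesWord I ++
    (ones (I.numVars * I.weight) ++ ([true] ++ (constraintWord I false ++ [false]))) := by
  have htable : ((List.finRange I.numVars).flatMap fun u =>
      (List.finRange I.weight).map fun r => decide ((u, r) ∈ (Finset.univ :
        Finset (Fin I.numVars × Fin I.weight)))) = ones (I.numVars * I.weight) := by
    rw [← flatMap_range_ones, ← flatMap_finRange]
    refine List.flatMap_congr fun u _ => ?_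
    simp [ones]
  simp only [ParamProblem.word, apep, APEPInstance.word, apepOf, htable]
  simp [listWord, sizesWord, constraintWord]
  rfl

theorem valuedAPEP_word_valuedAPEPOf : valuedAPEP.word (valuedAPEPOf I) = sizesWord I ++
    ([true] ++ (constraintWord I true ++ ([false] ++
      (((List.range I.numVars).flatMap fun _ => [false, false]) ++ [false])))) := by
  rw [← flatMap_finRange]
  simp only [ParamProblem.word, valuedAPEP, ValuedAPEPInstance.word, valuedAPEPOf]
  simp [listWord, sizesWord, constraintWord, zeroCircuit, Circuit.word, binaryWord]
  rfl

theorem emits_apepBody : Emits apepBody (store 0 0 0 0 (wcsWord I)) (fun _ => [])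
    (apep.word (apepOf I)) (apepTime (wcsWord I).length) := by
  have hlen := length_wcsWord I
  have hg := length_gates_le I
  have hn : I.numVars ≤ (wcsWord I).length := by omega
  have hk : I.weight ≤ (wcsWord I).length := by omega
  rw [apep_word_apepOf]
  refine ((emits_emitSizes hn hk).seq <|
    ((ready_store I.numVars I.weight 0 0 _).emits_total hn hk).seq <|
    (emits_emitWord _ [true]).seq <|
    (emits_emitCircuit false hn hk I.circuit (by unfold circuitWord at hlen; omega)).seq <|
    (emits_emitWord _ [false]).seq (emits_cleanup hn hk (by omega))).congr ?_
  simp [sizesWord, constraintWord]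

theorem emits_valuedBody : Emits valuedBody (store 0 0 0 0 (wcsWord I)) (fun _ => [])
    (valuedAPEP.word (valuedAPEPOf I)) (valuedTime (wcsWord I).length) := by
  have hlen := length_wcsWord I
  have hg := length_gates_le I
  have hn : I.numVars ≤ (wcsWord I).length := by omega
  have hk : I.weight ≤ (wcsWord I).length := by omega
  rw [valuedAPEP_word_valuedAPEPOf]
  refine ((emits_emitSizes hn hk).seq <|
    (emits_emitWord _ [true]).seq <|
    (emits_emitCircuit true hn hk I.circuit (by unfold circuitWord at hlen; omega)).seq <|
    (emits_emitWord _ [false]).seq <|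
    (emits_forEach (cnt := .users) (idx := .idxU) (m := I.numVars) (by decide) (by decide)
      (by decide) rfl rfl hn (fun _ => [false, false])
      fun _ _ _ => emits_emitWord _ [false, false]).seq <|
    (emits_emitWord _ [false]).seq (emits_cleanup hn hk (by omega))).congr ?_
  simp [sizesWord, constraintWord]

end

/-! ### Hardness -/

/-- A program whose running time is bounded by a polynomial gives a parameterized reduction. -/
theorem reduces_of_emits {P Q : ParamProblem} {d : ℕ} (hP : P.Reduces (weightedCircuitSat 1 d))
    (f : WCSInstance → Q.Inst) (c : Cmd Stk) (t : ℕ → ℕ) (ht : PolyBound t)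
    (hyes : ∀ I : WCSInstance, Q.Yes (f I) ↔ ∃ a : Fin I.numVars → Bool,
      (Finset.univ.filter fun i => a i = true).card = I.weight ∧ I.circuit.Accepts a)
    (hparam : ∀ I, Q.param (f I) = I.weight)
    (hc : ∀ I, Emits c (store 0 0 0 0 (wcsWord I)) (fun _ => []) (Q.word (f I))
      (t (wcsWord I).length)) : P.Reduces Q := by
  -- The bound of `runs_wrap`: reading the input, the program itself, and pouring out at most `t`
  -- bits.
  obtain ⟨a, e, h⟩ :=
    ((PolyBound.id.add (PolyBound.const 1)).add (ht.add (ht.add (PolyBound.const 1))))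
  refine hP.then_program (wrap c) .io (fun I => f I.1) (fun I => (hyes I.1).symm)
    (fun I => (hparam I.1).le) (a * 2 ^ e) e fun I => ?_
  have hword : (weightedCircuitSat 1 d).word I = wcsWord I.1 := rfl
  rw [hword]
  obtain ⟨s, hs, hr⟩ := runs_wrap (hc I.1)
  refine ⟨s, hs.trans ((h _).trans ?_), hr⟩
  -- The word is nonempty, so `L + 1 ≤ 2 * L`; this is the origin of the factor `2 ^ e`.
  have h1 : 1 ≤ (wcsWord I.1).length := by rw [length_wcsWord]; omega
  calc a * ((wcsWord I.1).length + 1) ^ e ≤ a * (2 * (wcsWord I.1).length) ^ e := by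
        gcongr; omega
    _ = _ := by rw [mul_pow, mul_assoc]

theorem wHard_restrict_apep :
    WHard 1 (apep.restrict fun I => I.IsWBounded I.k ∧ I.AllBounded I.k) := by
  rintro P ⟨d, hP⟩
  exact reduces_of_emits hP (fun I => ⟨apepOf I, bounded_apepOf I⟩) apepBody apepTime
    PolyBound.apepTime exists_valid_apepOf (fun _ => rfl) emits_apepBody

theorem wHard_restrict_valuedAPEP :
    WHard 1 (valuedAPEP.restrict fun I => I.IsWBounded I.k ∧ I.AllBounded I.k) := by
  rintro P ⟨d, hP⟩
  exact reduces_of_emits hP (fun I => ⟨valuedAPEPOf I, bounded_valuedAPEPOf I⟩) valuedBody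
    valuedTime PolyBound.valuedTime exists_weight_valuedAPEPOf_le (fun _ => rfl)
    emits_valuedBody

theorem WHard.of_restrict {t : ℕ} {Q : ParamProblem} {p : Q.Inst → Prop}
    (h : WHard t (Q.restrict p)) : WHard t Q := fun P hP => (h P hP).of_restrict

end ParamAPEP

theorem mainTheorem7 :
    ParamAPEP.WHard 1 ParamAPEP.apep ∧
    ParamAPEP.WHard 1 ParamAPEP.valuedAPEP ∧
    ParamAPEP.WHard 1 (ParamAPEP.apep.restrict fun I : ParamAPEP.APEPInstance =>
      I.IsWBounded I.k ∧ I.AllBounded I.k) ∧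
    ParamAPEP.WHard 1 (ParamAPEP.valuedAPEP.restrict fun I : ParamAPEP.ValuedAPEPInstance =>
      I.IsWBounded I.k ∧ I.AllBounded I.k) :=
  ⟨ParamAPEP.wHard_restrict_apep.of_restrict, ParamAPEP.wHard_restrict_valuedAPEP.of_restrict,
    ParamAPEP.wHard_restrict_apep, ParamAPEP.wHard_restrict_valuedAPEP⟩
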